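/- Let $\hat q,\hat p$ be the position and momentum operators on $L^2(\mathbb R)$ ($\hbar=1$), $\hat a=(\hat q+i\hat p)/\sqrt2$, $\hat n=\hat a^\dagger\hat a$, let $|n\rangle_f$ be the Fock states, and let $\hat F=\exp(\pi i\hat n/2)$ be the Fourier operator. For $\mathbf r=(r_1,r_2)$ let $\hat V(\mathbf r)=e^{-ir_1r_2/2}\,e^{ir_1\hat q}e^{-ir_2\hat p}$. For an integer $d\ge 1$ put $\alpha_d=\sqrt{2\pi/d}$, and for $j\in\{0,\dots,d-1\}$ let $$|j^{(\mathrm{ideal})}\rangle=\sqrt{\alpha_d d}\,\sum_{s\in\mathbb Z}|\alpha_d(ds+j)\rangle_{\hat q}$$ (a Dirac comb, as a tempered distribution). For $\beta>0$ and for real $\gamma,\delta$ with $0<\gamma\delta<2$ define the vectors of $L^2(\mathbb R)$ $$|j^{(3)}_\beta\rangle=\frac1{\sqrt{N^{(3)}_{\beta,j}}}\,e^{-\beta(\hat n+\frac12)}|j^{(\mathrm{ideal})}\rangle,\qquad |j^{(2)}_{\gamma,\delta}\rangle=\frac1{\sqrt{N^{(2)}_{\gamma,\delta,j}}}\iint\frac{dr_1dr_2}{2\pi\gamma\delta}\,e^{-\frac{r_1^2}{2\gamma^2}-\frac{r_2^2}{2\delta^2}}\,\hat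 V(\mathbf r)|j^{(\mathrm{ideal})}\rangle,$$ where $N^{(3)}_{\beta,j},N^{(2)}_{\gamma,\delta,j}>0$ are the constants that make these unit vectors (the unnormalized vectors lie in $L^2(\mathbb R)$ and are nonzero). Then: (1) For all $\beta>0$ and all $j$, $$\hat F^\dagger|j^{(3)}_\beta\rangle=\frac1{\sqrt d}\sum_{j'=0}^{d-1}e^{-2\pi i jj'/d}\sqrt{\frac{N^{(3)}_{\beta,j'}}{N^{(3)}_{\beta,j}}}\;|j'^{(3)}_\beta\rangle .$$ Hence the code space $\mathrm{span}\{|j^{(3)}_\beta\rangle:0\le j<d\}$ is mapped onto itself by $\hat F$. (2) For all real $\gamma,\delta$ with $0<\gamma\delta<2$ and every $j$, the same relation $$\hat F^\dagger|j^{(2)}_{\gamma,\delta}\rangle=\frac1{\sqrt d}\sum_{j'=0}^{d-1}e^{-2\pi i jj'/d}\sqrt{\frac{N^{(2)}_{\gamma,\delta,j'}}{N^{(2)}_{\gamma,\delta,j}}}\;|j'^{(2)}_{\gamma,\delta}\rangle$$ holds if and only if $\gamma=\delta$. -/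

import Mathlib

open MeasureTheory SchwartzMap
open scoped InnerProductSpace ContDiff Nat
noncomputable section
namespace GKP

/-- The Hilbert space `L²(ℝ)` of one oscillator mode, in the position representation. -/
abbrev L2 : Type := Lp ℂ 2 (volume : Measure ℝ)

theorem pow_mul_gauss_le (m : ℕ) (x : ℝ) :
    |x| ^ m * Real.exp (-(x ^ 2 / 2)) ≤ m ! * Real.exp 1 := by
  have h1 : |x| ^ m ≤ m ! * Real.exp |x| := by
    have := Real.pow_div_factorial_le_exp |x| (abs_nonneg x) m
    rwa [div_le_iff₀ (by positivity), mul_comm] at this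
  calc _ ≤ m ! * Real.exp |x| * Real.exp (-(x ^ 2 / 2)) := by gcongr
    _ = m ! * Real.exp (|x| - x ^ 2 / 2) := by rw [mul_assoc, ← Real.exp_add, sub_eq_add_neg]
    _ ≤ _ := by
      gcongr
      nlinarith [sq_nonneg (|x| - 1), sq_abs x]

/-- The Gaussian `exp (-x² / 2)` as a Schwartz function. -/
def gaussianSchwartz : 𝓢(ℝ, ℝ) where
  toFun x := Real.exp (-(x ^ 2 / 2))
  smooth' := by fun_prop
  decay' k n := by
    refine ⟨∑ i ∈ Finset.range ((Polynomial.hermite n).natDegree + 1),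
      |((Polynomial.hermite n).coeff i : ℝ)| * ((i + k) ! * Real.exp 1), fun x => ?_⟩
    rw [norm_iteratedFDeriv_eq_norm_iteratedDeriv, iteratedDeriv_eq_iterate,
      Polynomial.deriv_gaussian_eq_hermite_mul_gaussian, Polynomial.aeval_eq_sum_range]
    simp only [Real.norm_eq_abs, abs_mul, abs_pow, abs_neg, abs_one, one_pow, one_mul, Real.abs_exp]
    calc _ ≤ |x| ^ k * ((∑ i ∈ Finset.range ((Polynomial.hermite n).natDegree + 1),
            |((Polynomial.hermite n).coeff i : ℝ)| * |x| ^ i) * Real.exp (-(x ^ 2 / 2))) := by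
          gcongr
          refine (Finset.abs_sum_le_sum_abs _ _).trans (le_of_eq ?_)
          refine Finset.sum_congr rfl fun i _ => ?_
          rw [zsmul_eq_mul, abs_mul, abs_pow]
      _ = ∑ i ∈ Finset.range ((Polynomial.hermite n).natDegree + 1),
            |((Polynomial.hermite n).coeff i : ℝ)| * (|x| ^ (i + k) * Real.exp (-(x ^ 2 / 2))) := by
          rw [Finset.sum_mul, Finset.mul_sum]
          refine Finset.sum_congr rfl fun i _ => ?_
          rw [pow_add]; ring
      _ ≤ _ := by
          refine Finset.sum_le_sum fun i _ => ?_
          exact mul_le_mul_of_nonneg_left (pow_mul_gauss_le _ _) (abs_nonneg _)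

/-- The vacuum `|0⟩_f`, with wave function `π^(-1/4) exp (-x² / 2)`. -/
def vacuum : 𝓢(ℝ, ℂ) :=
  ((Real.pi ^ (-(1 / 4) : ℝ) : ℝ) : ℂ) • gaussianSchwartz.postcompCLM Complex.ofRealCLM

/-- The position operator `q̂` (multiplication by `x`) on Schwartz functions. -/
def position : 𝓢(ℝ, ℂ) →L[ℂ] 𝓢(ℝ, ℂ) := smulLeftCLM ℂ (fun x : ℝ => (x : ℂ))
/-- The momentum operator `p̂ = -i d/dx` on Schwartz functions (`ħ = 1`). -/
def momentum : 𝓢(ℝ, ℂ) →L[ℂ] 𝓢(ℝ, ℂ) := (-Complex.I) • derivCLM ℂ ℂ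
/-- The annihilation operator `â = (q̂ + i p̂) / √2`. -/
def annihilation : 𝓢(ℝ, ℂ) →L[ℂ] 𝓢(ℝ, ℂ) :=
  ((√2 : ℝ) : ℂ)⁻¹ • (position + Complex.I • momentum)
/-- The creation operator `â† = (q̂ - i p̂) / √2`. -/
def creation : 𝓢(ℝ, ℂ) →L[ℂ] 𝓢(ℝ, ℂ) :=
  ((√2 : ℝ) : ℂ)⁻¹ • (position - Complex.I • momentum)
/-- The number operator `n̂ = â† â` on Schwartz functions. -/
def number : 𝓢(ℝ, ℂ) →L[ℂ] 𝓢(ℝ, ℂ) := creation ∘L annihilation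

/-- The Fock state `|n⟩_f = (â†)ⁿ |0⟩_f / √(n!)`; its wave function is real-valued. -/
def fockS : ℕ → 𝓢(ℝ, ℂ)
  | 0 => vacuum
  | n + 1 => ((√(n + 1) : ℝ) : ℂ)⁻¹ • creation (fockS n)

/-- The Fock state `|n⟩_f` as a vector of `L²(ℝ)`. -/
def fock (n : ℕ) : L2 := (fockS n).toLp 2

theorem vacuum_apply (x : ℝ) :
    vacuum x = ((Real.pi ^ (-(1 / 4) : ℝ) * Real.exp (-(x ^ 2 / 2)) : ℝ) : ℂ) := by
  have : gaussianSchwartz x = Real.exp (-(x ^ 2 / 2)) := rfl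
  simp [vacuum, this]

theorem position_apply (f : 𝓢(ℝ, ℂ)) (x : ℝ) : position f x = x * f x := by
  have h : (fun x : ℝ => (x : ℂ)).HasTemperateGrowth := by fun_prop
  simp [position, smulLeftCLM_apply_apply h]

theorem annihilation_apply (f : 𝓢(ℝ, ℂ)) (x : ℝ) :
    annihilation f x = ((√2 : ℝ) : ℂ)⁻¹ * (x * f x + deriv f x) := by
  simp [annihilation, momentum, position_apply, ← mul_assoc]; ring

theorem creation_apply (f : 𝓢(ℝ, ℂ)) (x : ℝ) :
    creation f x = ((√2 : ℝ) : ℂ)⁻¹ * (x * f x - deriv f x) := by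
  simp [creation, momentum, position_apply, ← mul_assoc]; ring

theorem sqrt_two_inv_mul : ((√2 : ℝ) : ℂ)⁻¹ * ((√2 : ℝ) : ℂ)⁻¹ = 1 / 2 := by
  rw [← mul_inv, ← Complex.ofReal_mul, Real.mul_self_sqrt (by norm_num)]; norm_num

theorem annihilation_creation (f : 𝓢(ℝ, ℂ)) :
    annihilation (creation f) = number f + f := by
  ext x
  have hx : HasDerivAt (fun y : ℝ => (y : ℂ)) 1 x := Complex.ofRealCLM.hasDerivAt
  have hf := f.hasDerivAt x
  have hf' : HasDerivAt (deriv f) (deriv (deriv f) x) x := (derivCLM ℂ ℂ f).hasDerivAt x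
  have h1 : deriv (creation f) x =
      ((√2 : ℝ) : ℂ)⁻¹ * (f x + x * deriv f x - deriv (deriv f) x) := by
    have : (creation f : ℝ → ℂ) = fun y => ((√2 : ℝ) : ℂ)⁻¹ * (y * f y - deriv f y) :=
      funext (creation_apply f)
    rw [this]; refine (((hx.mul hf).sub hf').const_mul _).deriv.trans ?_; ring
  have h2 : deriv (annihilation f) x =
      ((√2 : ℝ) : ℂ)⁻¹ * (f x + x * deriv f x + deriv (deriv f) x) := by
    have : (annihilation f : ℝ → ℂ) = fun y => ((√2 : ℝ) : ℂ)⁻¹ * (y * f y + deriv f y) :=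
      funext (annihilation_apply f)
    rw [this]; refine (((hx.mul hf).add hf').const_mul _).deriv.trans ?_; ring
  simp only [number, ContinuousLinearMap.comp_apply, add_apply]
  rw [annihilation_apply, creation_apply, creation_apply, annihilation_apply, h1, h2]
  linear_combination 2 * f x * sqrt_two_inv_mul

theorem annihilation_vacuum : annihilation vacuum = 0 := by
  ext x
  have : (vacuum : ℝ → ℂ) =
      fun x => ((Real.pi ^ (-(1 / 4) : ℝ) * Real.exp (-(x ^ 2 / 2)) : ℝ) : ℂ) :=
    funext vacuum_apply
  have h : HasDerivAt vacuum (-x * vacuum x) x := by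
    have h0 : HasDerivAt (fun x : ℝ => Real.pi ^ (-(1 / 4) : ℝ) * Real.exp (-(x ^ 2 / 2)))
        (-x * (Real.pi ^ (-(1 / 4) : ℝ) * Real.exp (-(x ^ 2 / 2)))) x := by
      have := (((hasDerivAt_pow 2 x).div_const 2).neg.exp).const_mul (Real.pi ^ (-(1 / 4) : ℝ))
      refine this.congr_deriv ?_
      simp only [Pi.neg_apply]
      push_cast; ring
    rw [this]
    convert h0.ofReal_comp using 1
    push_cast; ring
  rw [annihilation_apply, h.deriv]
  simp

theorem sqrt_succ_mul_self (n : ℕ) :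
    ((√(n + 1) : ℝ) : ℂ) * ((√(n + 1) : ℝ) : ℂ) = (n + 1 : ℂ) := by
  rw [← Complex.ofReal_mul, Real.mul_self_sqrt (by positivity)]; push_cast; rfl

/-- `n̂ |n⟩_f = n |n⟩_f`. -/
theorem number_fockS (n : ℕ) : number (fockS n) = (n : ℂ) • fockS n := by
  induction n with
  | zero => simp [fockS, number, annihilation_vacuum]
  | succ n ih =>
    have : number (fockS (n + 1)) =
        ((√(n + 1) : ℝ) : ℂ)⁻¹ • creation (annihilation (creation (fockS n))) := by
      simp [fockS, number]
    rw [this, annihilation_creation, ih, fockS]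
    simp only [map_add, map_smul, smul_smul, smul_add]
    rw [← add_smul]
    congr 1
    push_cast; ring

theorem inner_creation (f g : 𝓢(ℝ, ℂ)) :
    ⟪(creation f).toLp 2 volume, g.toLp 2 volume⟫_ℂ =
      ⟪f.toLp 2 volume, (annihilation g).toLp 2 volume⟫_ℂ := by
  rw [inner_toL2_toL2_eq _ _ volume, inner_toL2_toL2_eq _ _ volume]
  let L : ℂ →L[ℝ] ℂ →L[ℝ] ℂ :=
    (ContinuousLinearMap.mul ℝ ℂ).comp (Complex.conjCLE : ℂ →L[ℝ] ℂ)
  have hL : ∀ u v : ℂ, L u v = starRingEnd ℂ u * v := fun u v => by simp [L]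
  have hp := integral_bilinear_deriv_right_eq_neg_left f g L
  have i1 : Integrable (fun x => L (f x) (deriv g x)) := (pairing L f (derivCLM ℂ ℂ g)).integrable
  have i2 : Integrable (fun x => L (deriv f x) (g x)) := (pairing L (derivCLM ℂ ℂ f) g).integrable
  have i3 : Integrable (fun x => L (f x) (position g x)) := (pairing L f (position g)).integrable
  simp only [hL] at hp i1 i2 i3
  have e1 : ∀ x, ⟪creation f x, g x⟫_ℂ = ((√2 : ℝ) : ℂ)⁻¹ *
      (starRingEnd ℂ (f x) * position g x - starRingEnd ℂ (deriv f x) * g x) := fun x => by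
    rw [creation_apply, position_apply]; simp; ring
  have e2 : ∀ x, ⟪f x, annihilation g x⟫_ℂ = ((√2 : ℝ) : ℂ)⁻¹ *
      (starRingEnd ℂ (f x) * position g x + starRingEnd ℂ (f x) * deriv g x) := fun x => by
    rw [annihilation_apply, position_apply]; simp; ring
  simp only [e1, e2]
  rw [integral_const_mul, integral_const_mul, integral_sub i3 i2, integral_add i3 i1, hp]
  ring

theorem toLp_smul (c : ℂ) (f : 𝓢(ℝ, ℂ)) :
    (c • f).toLp 2 volume = c • f.toLp 2 (volume : Measure ℝ) :=
  (toLpCLM ℂ ℂ 2 (volume : Measure ℝ)).map_smul c f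

theorem inner_number (f g : 𝓢(ℝ, ℂ)) :
    ⟪(number f).toLp 2 volume, g.toLp 2 volume⟫_ℂ =
      ⟪f.toLp 2 volume, (number g).toLp 2 volume⟫_ℂ := by
  have h1 := inner_creation (annihilation f) g
  have h2 := inner_creation (annihilation g) f
  calc _ = _ := h1
    _ = starRingEnd ℂ ⟪(annihilation g).toLp 2 volume, (annihilation f).toLp 2 volume⟫_ℂ :=
        (inner_conj_symm _ _).symm
    _ = starRingEnd ℂ ⟪(number g).toLp 2 volume, f.toLp 2 volume⟫_ℂ := by rw [← h2]; rfl
    _ = _ := inner_conj_symm _ _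

theorem inner_vacuum : ⟪vacuum.toLp 2 volume, vacuum.toLp 2 volume⟫_ℂ = 1 := by
  rw [inner_toL2_toL2_eq _ _ volume]
  have e : ∀ x, ⟪vacuum x, vacuum x⟫_ℂ =
      ((Real.pi ^ (-(1 / 2) : ℝ) * Real.exp (-1 * x ^ 2) : ℝ) : ℂ) := fun x => by
    rw [vacuum_apply, RCLike.inner_apply, Complex.conj_ofReal, ← Complex.ofReal_mul]
    congr 1
    have h1 : Real.pi ^ (-(1 / 2) : ℝ) = Real.pi ^ (-(1 / 4) : ℝ) * Real.pi ^ (-(1 / 4) : ℝ) := by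
      rw [← Real.rpow_add Real.pi_pos]; norm_num
    have h2 : Real.exp (-1 * x ^ 2) = Real.exp (-(x ^ 2 / 2)) * Real.exp (-(x ^ 2 / 2)) := by
      rw [← Real.exp_add]; congr 1; ring
    rw [h1, h2]; ring
  simp only [e]
  rw [integral_complex_ofReal, integral_const_mul, integral_gaussian, div_one, Real.sqrt_eq_rpow,
    ← Real.rpow_add Real.pi_pos]
  norm_num

theorem orthonormal_fock : Orthonormal ℂ fock := by
  have hn : ∀ n, ⟪fock n, fock n⟫_ℂ = 1 := fun n => by
    induction n with
    | zero => exact inner_vacuum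
    | succ n ih =>
      have h0 : ((√(n + 1) : ℝ) : ℂ) ≠ 0 := by
        rw [Complex.ofReal_ne_zero]; positivity
      have h1 : ((n : ℂ) + 1) ≠ 0 := by exact_mod_cast Nat.succ_ne_zero n
      have h2 : annihilation (creation (fockS n)) = ((n : ℂ) + 1) • fockS n := by
        rw [annihilation_creation, number_fockS, add_smul, one_smul]
      have h3 := inner_creation (fockS n) (creation (fockS n))
      rw [h2, toLp_smul, inner_smul_right] at h3
      change ⟪(fockS (n + 1)).toLp 2 volume, (fockS (n + 1)).toLp 2 volume⟫_ℂ = 1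
      change ⟪(fockS n).toLp 2 volume, (fockS n).toLp 2 volume⟫_ℂ = 1 at ih
      rw [fockS, toLp_smul, inner_smul_left, inner_smul_right, h3, ih, ← Complex.ofReal_inv,
        Complex.conj_ofReal, Complex.ofReal_inv, mul_one, ← sqrt_succ_mul_self]
      field_simp
  rw [orthonormal_iff_ite]
  intro m n
  split_ifs with h
  · rw [← h, hn]
  · have := inner_number (fockS m) (fockS n)
    rw [number_fockS, number_fockS, toLp_smul, toLp_smul, inner_smul_left, inner_smul_right,
      Complex.conj_natCast] at this
    have h' : ((m : ℂ) - n) ≠ 0 := sub_ne_zero.2 (by exact_mod_cast h)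
    change ⟪(fockS m).toLp 2 volume, (fockS n).toLp 2 volume⟫_ℂ = 0
    refine (mul_eq_zero.1 (?_ : ((m : ℂ) - n) * _ = 0)).resolve_left h'
    rw [sub_mul, this, sub_self]

theorem norm_phase (n : ℕ) : ‖Complex.exp (Real.pi * Complex.I * n / 2)‖ = 1 := by
  rw [show (Real.pi * Complex.I * n / 2 : ℂ) = ((Real.pi * n / 2 : ℝ) : ℂ) * Complex.I by
    push_cast; ring]
  exact Complex.norm_exp_ofReal_mul_I _

theorem summable_phase (f : L2) : Summable fun n : ℕ =>
    (Complex.exp (Real.pi * Complex.I * n / 2) * ⟪fock n, f⟫_ℂ) • fock n := by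
  have h := orthonormal_fock.orthogonalFamily.summable_iff_norm_sq_summable
    (fun n => Complex.exp (Real.pi * Complex.I * n / 2) * ⟪fock n, f⟫_ℂ)
  simp only [LinearIsometry.toSpanSingleton_apply] at h
  rw [h]
  simp only [norm_mul, norm_phase, one_mul]
  exact orthonormal_fock.inner_products_summable f

/-- The Fourier operator `F̂ = exp (π i n̂ / 2) = ∑ₙ exp (π i n / 2) |n⟩⟨n|_f`, a bounded operator
on `L²(ℝ)`. -/
def fourierOp : L2 →L[ℂ] L2 :=
  LinearMap.mkContinuous
    { toFun := fun f => ∑' n : ℕ,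
        (Complex.exp (Real.pi * Complex.I * n / 2) * ⟪fock n, f⟫_ℂ) • fock n
      map_add' := fun f g => by
        rw [← (summable_phase f).tsum_add (summable_phase g)]
        simp only [inner_add_right, mul_add, add_smul]
      map_smul' := fun c f => by
        rw [RingHom.id_apply, ← tsum_const_smul'']
        simp only [inner_smul_right, smul_smul, mul_left_comm] }
    1 fun f => by
      rw [one_mul]
      refine le_of_tendsto (summable_phase f).hasSum.norm (Filter.Eventually.of_forall fun s => ?_)
      have h := orthonormal_fock.orthogonalFamily.norm_sum
        (fun n => Complex.exp (Real.pi * Complex.I * n / 2) * ⟪fock n, f⟫_ℂ) s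
      simp only [LinearIsometry.toSpanSingleton_apply, norm_mul, norm_phase, one_mul] at h
      refine (sq_le_sq₀ (norm_nonneg _) (norm_nonneg _)).1 ?_
      exact h.trans_le (orthonormal_fock.sum_inner_products_le f)

/-- The displacement `X̂(r) = exp (-i r p̂)` on tempered distributions: it translates by `r`,
`f(q) ↦ f(q - r)`. -/
def dispX (r : ℝ) : 𝓢'(ℝ, ℂ) →L[ℂ] 𝓢'(ℝ, ℂ) :=
  PointwiseConvergenceCLM.precomp ℂ (compSubConstCLM ℂ (-r))

/-- The displacement `Ẑ(r) = exp (i r q̂)` on tempered distributions: `f(q) ↦ exp (i r q) f(q)`. -/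
def dispZ (r : ℝ) : 𝓢'(ℝ, ℂ) →L[ℂ] 𝓢'(ℝ, ℂ) :=
  TemperedDistribution.smulLeftCLM ℂ (fun q : ℝ => Complex.exp (Complex.I * r * q))

/-- The Weyl-Heisenberg displacement `V̂(r) = exp (-i r_p r_q / 2) Ẑ(r_p) X̂(r_q)`, for
`r = (r_p, r_q)`. -/
def dispV (r : ℝ × ℝ) : 𝓢'(ℝ, ℂ) →L[ℂ] 𝓢'(ℝ, ℂ) :=
  Complex.exp (-Complex.I * r.1 * r.2 / 2) • (dispZ r.1 ∘L dispX r.2)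

/-- `α_d = √(2π / d)`. -/
def alpha (d : ℕ) : ℝ := √(2 * Real.pi / d)

/-- The ideal code state `√(α_d d) ∑_{s ∈ ℤ} |α_d (d s + j)⟩_q`, a Dirac comb. The sum is taken in
the space of tempered distributions with the topology of pointwise convergence. -/
def idealState (d : ℕ) (j : Fin d) : 𝓢'(ℝ, ℂ) :=
  ((√(alpha d * d) : ℝ) : ℂ) •
    ∑' s : ℤ, TemperedDistribution.delta (alpha d * (d * s + (j : ℕ)))

/-- The unnormalized state `exp (-β (n̂ + 1/2)) |j_ideal⟩ = ∑ₙ exp (-β (n + 1/2)) ⟨n|j_ideal⟩ |n⟩`,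
with the sum in `L²(ℝ)`. Since the Fock wave functions are real, `⟨n|j_ideal⟩` is the value of the
distribution at the Fock wave function. -/
def approx3Vec (d : ℕ) (β : ℝ) (j : Fin d) : L2 :=
  ∑' n : ℕ, (((Real.exp (-β * (n + 1 / 2)) : ℝ) : ℂ) * idealState d j (fockS n)) • fock n

/-- The normalization constant of Approximation 3. -/
def N3 (d : ℕ) (β : ℝ) (j : Fin d) : ℝ := ‖approx3Vec d β j‖ ^ 2

/-- The logical basis state of Approximation 3. -/
def ket3 (d : ℕ) (β : ℝ) (j : Fin d) : L2 := (((√(N3 d β j))⁻¹ : ℝ) : ℂ) • approx3Vec d β j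

/-- The code space of Approximation 3. -/
def codeSpace3 (d : ℕ) (β : ℝ) : Submodule ℂ L2 := Submodule.span ℂ (Set.range (ket3 d β))

/-- The Gaussian error wave function
`exp (-r₁² / (2γ²) - r₂² / (2δ²)) / (2πγδ)`, for `r = (r₁, r₂) = (r_p, r_q)`. -/
def errorWave (γ δ : ℝ) (r : ℝ × ℝ) : ℝ :=
  Real.exp (-(r.1 ^ 2 / (2 * γ ^ 2)) - r.2 ^ 2 / (2 * δ ^ 2)) / (2 * Real.pi * γ * δ)

/-- The vector `f` of `L²(ℝ)` is the (weak) integral `∬ errorWave(r) V̂(r) |j_ideal⟩ dr₁ dr₂` in the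
space of tempered distributions. -/
def IsApprox2Vec (d : ℕ) (γ δ : ℝ) (j : Fin d) (f : L2) : Prop :=
  ∀ u : 𝓢(ℝ, ℂ),
    Integrable (fun r : ℝ × ℝ => (errorWave γ δ r : ℂ) * dispV r (idealState d j) u) ∧
    (f : 𝓢'(ℝ, ℂ)) u = ∫ r : ℝ × ℝ, (errorWave γ δ r : ℂ) * dispV r (idealState d j) u

open Classical in
/-- The unnormalized state `∬ errorWave(r) V̂(r) |j_ideal⟩ dr₁ dr₂`: the unique vector of `L²(ℝ)` that
is this weak integral (and `0`, should there be none). -/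
def approx2Vec (d : ℕ) (γ δ : ℝ) (j : Fin d) : L2 :=
  if h : ∃ f : L2, IsApprox2Vec d γ δ j f then h.choose else 0

/-- The normalization constant of Approximation 2. -/
def N2 (d : ℕ) (γ δ : ℝ) (j : Fin d) : ℝ := ‖approx2Vec d γ δ j‖ ^ 2

/-- The logical basis state of Approximation 2. -/
def ket2 (d : ℕ) (γ δ : ℝ) (j : Fin d) : L2 :=
  (((√(N2 d γ δ j))⁻¹ : ℝ) : ℂ) • approx2Vec d γ δ j

/-- The entry `exp (-2π i j k / d) / √d` of the unitary discrete Fourier transform. -/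
def dftCoeff (d : ℕ) (j k : Fin d) : ℂ :=
  Complex.exp (-(2 * Real.pi * Complex.I * (j : ℕ) * (k : ℕ) / d)) / ((√d : ℝ) : ℂ)

end GKP

end

noncomputable section
namespace GKP

/-! `F̂†` and the unitary Fourier transform `fourierU` on Schwartz functions have the same
eigenvalue `(-i)^n` on each Fock state (`fourierU_fockS`, `inner_fock_adjoint_fourierOp`), and the
Fock states are complete (`ext_inner_fock`). Identities in `L²` can therefore be tested on Fock
coefficients, where `F̂†` becomes `fourierU` acting on the test function. Since `α_d² d = 2π`,
Poisson summation says that `fourierU` acts on the ideal combs as the discrete Fourier transform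
(`idealState_fourierU`).

Part (1): the damping `exp (-β (n̂ + 1/2))` is diagonal in the Fock basis, so it commutes with `F̂†`
and the comb relation survives. The analytic input is convergence: the Fock functions are bounded
and decay with constants polynomial in `n` (`exists_fockS_decay`), which the damping beats.

Part (2): `fourierU` rotates displacements by a quarter turn, so `F̂†` sends the `(γ, δ)` state to
the discrete Fourier transform of the `(δ, γ)` states (`adjoint_fourierOp_approx2Vec`). This settles
`γ = δ`. Conversely, the relation forces the transformed `(γ, δ)` and `(δ, γ)` states to agree. Each
is a single phased comb over all of `α_d ℤ`, smeared by an explicit Gaussian kernel. A lattice step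
`a` in `y` is compensated by a shift `t` in `x`, where `t` depends on the widths only through `γδ`,
up to a factor `exp` of an affine function of `x` whose slope, for fixed `γδ`, is proportional to
`1/δ²` (`combWave_add`). Comparing the factors at two points where the wave is nonzero equates the
slopes, so `γ² = δ²` (`eq_of_combWave_eq`). The bound `γδ < 2` keeps `4 - γ²δ²`, the denominator of
`t`, positive. -/

/-! ### Ladder relations and reality of the Fock functions -/

theorem sqrt_succ_ne_zero (n : ℕ) : ((√(n + 1) : ℝ) : ℂ) ≠ 0 := by
  rw [Complex.ofReal_ne_zero]; positivity

theorem creation_fockS (n : ℕ) :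
    creation (fockS n) = ((√(n + 1) : ℝ) : ℂ) • fockS (n + 1) := by
  rw [fockS, smul_smul, mul_inv_cancel₀ (sqrt_succ_ne_zero n), one_smul]

theorem annihilation_fockS_succ (n : ℕ) :
    annihilation (fockS (n + 1)) = ((√(n + 1) : ℝ) : ℂ) • fockS n := by
  rw [fockS, map_smul, annihilation_creation, number_fockS]
  nth_rw 2 [← one_smul ℂ (fockS n)]
  rw [← add_smul, smul_smul, ← sqrt_succ_mul_self, ← mul_assoc,
    inv_mul_cancel₀ (sqrt_succ_ne_zero n), one_mul]

theorem annihilation_fockS_zero : annihilation (fockS 0) = 0 := annihilation_vacuum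

theorem position_eq_ladder :
    position = ((√2 : ℝ) : ℂ)⁻¹ • (annihilation + creation) := by
  ext f x
  simp only [add_apply, smul_apply]
  simp only [annihilation_apply, creation_apply, position_apply, smul_eq_mul]
  linear_combination (-2 * x * f x) * sqrt_two_inv_mul

theorem derivCLM_eq_ladder :
    derivCLM ℂ ℂ = ((√2 : ℝ) : ℂ)⁻¹ • (annihilation - creation) := by
  ext f x
  simp only [sub_apply, smul_apply]
  simp only [annihilation_apply, creation_apply, derivCLM_apply, smul_eq_mul]
  linear_combination (-2 * deriv f x) * sqrt_two_inv_mul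

theorem conj_deriv {f : 𝓢(ℝ, ℂ)} (hf : ∀ x, starRingEnd ℂ (f x) = f x) (x : ℝ) :
    starRingEnd ℂ (deriv f x) = deriv f x := by
  have h : HasDerivAt (fun y => starRingEnd ℂ (f y)) (starRingEnd ℂ (deriv f x)) x :=
    (Complex.conjCLE : ℂ →L[ℝ] ℂ).hasFDerivAt.comp_hasDerivAt x (f.hasDerivAt x)
  simp only [hf] at h
  exact h.deriv.symm

/-- The Fock wave functions are real-valued. -/
theorem conj_fockS (n : ℕ) (x : ℝ) : starRingEnd ℂ (fockS n x) = fockS n x := by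
  induction n generalizing x with
  | zero => rw [fockS, vacuum_apply, Complex.conj_ofReal]
  | succ n ih =>
    rw [fockS, smul_apply, creation_apply, smul_eq_mul]
    simp only [map_mul, map_inv₀, map_sub, Complex.conj_ofReal, ih, conj_deriv ih]

/-! ### The unitary Fourier transform and its Fock eigenvectors -/

/-- The dilation by `(2π)⁻¹`. -/
def twoPiDilation : ℝ ≃L[ℝ] ℝ :=
  ContinuousLinearEquiv.unitsEquivAut ℝ (Units.mk0 (2 * Real.pi)⁻¹ (by positivity))

theorem twoPiDilation_apply (x : ℝ) : twoPiDilation x = x * (2 * Real.pi)⁻¹ := by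
  simp [twoPiDilation]

/-- The unitary Fourier transform `u ↦ (2π)^(-1/2) ∫ exp (-i x y) u(x) dx` on Schwartz functions. -/
def fourierU : 𝓢(ℝ, ℂ) →L[ℂ] 𝓢(ℝ, ℂ) :=
  ((√(2 * Real.pi) : ℝ) : ℂ)⁻¹ •
    (compCLMOfContinuousLinearEquiv ℂ twoPiDilation ∘L fourierTransformCLM ℂ)

theorem fourierU_apply_eq_fourier (u : 𝓢(ℝ, ℂ)) (y : ℝ) :
    fourierU u y = ((√(2 * Real.pi) : ℝ) : ℂ)⁻¹ *
      FourierTransform.fourier (u : ℝ → ℂ) (y * (2 * Real.pi)⁻¹) := by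
  simp only [fourierU, ContinuousLinearMap.comp_apply, smul_apply,
    smul_eq_mul, fourierTransformCLM_apply, compCLMOfContinuousLinearEquiv_apply,
    Function.comp_apply, fourier_coe, twoPiDilation_apply]

theorem fourierU_apply (u : 𝓢(ℝ, ℂ)) (y : ℝ) :
    fourierU u y =
      ((√(2 * Real.pi) : ℝ) : ℂ)⁻¹ * ∫ x : ℝ, Complex.exp (-Complex.I * x * y) * u x := by
  rw [fourierU_apply_eq_fourier, Real.fourier_real_eq_integral_exp_smul]
  congr 2
  ext x
  rw [smul_eq_mul]
  congr 2
  have : (Real.pi : ℂ) ≠ 0 := by exact_mod_cast Real.pi_ne_zero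
  push_cast
  field_simp

theorem fourierU_deriv (u : 𝓢(ℝ, ℂ)) (y : ℝ) :
    fourierU (derivCLM ℂ ℂ u) y = Complex.I * y * fourierU u y := by
  have h : (derivCLM ℂ ℂ u : ℝ → ℂ) = deriv u := funext fun x => derivCLM_apply ℂ u x
  rw [fourierU_apply_eq_fourier, fourierU_apply_eq_fourier, h,
    Real.fourier_deriv u.integrable u.differentiable (h ▸ (derivCLM ℂ ℂ u).integrable)]
  have : (Real.pi : ℂ) ≠ 0 := by exact_mod_cast Real.pi_ne_zero
  simp only [smul_eq_mul]
  push_cast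
  field_simp

theorem deriv_fourierU (u : 𝓢(ℝ, ℂ)) (y : ℝ) :
    deriv (fourierU u) y = -Complex.I * fourierU (position u) y := by
  have hx : Integrable fun x : ℝ => x • u x := by
    have := (position u).integrable (μ := volume)
    refine this.congr (Filter.Eventually.of_forall fun x => ?_)
    simp [position_apply]
  have h1 := Real.hasDerivAt_fourier u.integrable hx (y * (2 * Real.pi)⁻¹)
  have h2 := (h1.scomp y ((hasDerivAt_id y).mul_const (2 * Real.pi)⁻¹)).const_mul
    ((√(2 * Real.pi) : ℝ) : ℂ)⁻¹
  have h3 : (fourierU u : ℝ → ℂ) = fun y => ((√(2 * Real.pi) : ℝ) : ℂ)⁻¹ *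
      FourierTransform.fourier (u : ℝ → ℂ) (y * (2 * Real.pi)⁻¹) :=
    funext (fourierU_apply_eq_fourier u)
  have h4 : (fun x : ℝ => (-2 * Real.pi * Complex.I * x : ℂ) • u x) =
      (((-2 * Real.pi * Complex.I : ℂ) • position u : 𝓢(ℝ, ℂ)) : ℝ → ℂ) := by
    ext x; simp [position_apply, mul_assoc]
  have h5 := h2.deriv
  have h6 : FourierTransform.fourier
      (((-2 * Real.pi * Complex.I : ℂ) • position u : 𝓢(ℝ, ℂ)) : ℝ → ℂ) (y * (2 * Real.pi)⁻¹) = (-2 * Real.pi * Complex.I : ℂ) *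
      FourierTransform.fourier ((position u : 𝓢(ℝ, ℂ)) : ℝ → ℂ) (y * (2 * Real.pi)⁻¹) := by
    have := congrArg (fun g : 𝓢(ℝ, ℂ) => g (y * (2 * Real.pi)⁻¹))
      ((fourierTransformCLM ℂ).map_smul (-2 * Real.pi * Complex.I : ℂ) (position u))
    exact this
  rw [h3]
  refine h5.trans ?_
  rw [h4, h6, fourierU_apply_eq_fourier]
  have : (Real.pi : ℂ) ≠ 0 := by exact_mod_cast Real.pi_ne_zero
  simp only [one_mul, Complex.real_smul]
  push_cast
  field_simp

/-- The transform exchanges multiplication by `x` and differentiation up to factors of `i`, and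
these factors combine so that `â†` is reproduced with a factor `-i`. Induction from the vacuum then
gives the eigenvalue `(-i)^n`. -/
theorem fourierU_creation (u : 𝓢(ℝ, ℂ)) :
    fourierU (creation u) = (-Complex.I) • creation (fourierU u) := by
  have h0 : creation u = ((√2 : ℝ) : ℂ)⁻¹ • (position u - derivCLM ℂ ℂ u) := by
    ext x; simp [creation_apply, position_apply]
  ext y
  rw [h0, map_smul, map_sub, smul_apply, sub_apply, fourierU_deriv, smul_apply, creation_apply,
    deriv_fourierU]
  simp only [smul_eq_mul]
  linear_combination (((√2 : ℝ) : ℂ)⁻¹ * fourierU (position u) y) * Complex.I_sq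

theorem fourierU_vacuum : fourierU vacuum = vacuum := by
  ext y
  rw [fourierU_apply, vacuum_apply]
  have h := fourierIntegral_gaussian (b := 1 / 2) (by norm_num) (-y)
  have e : ∀ x : ℝ, Complex.exp (-Complex.I * x * y) * vacuum x =
      ((Real.pi ^ (-(1 / 4) : ℝ) : ℝ) : ℂ) *
        (Complex.exp (Complex.I * (-y) * x) * Complex.exp (-(1 / 2) * x ^ 2)) := fun x => by
    rw [vacuum_apply]
    push_cast
    rw [show -Complex.I * x * y = Complex.I * (-y) * x by ring,
      show (-(1 / 2) * x ^ 2 : ℂ) = -(x ^ 2 / 2) by ring]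
    ring
  simp only [e]
  rw [integral_const_mul, h]
  have h2 : ((Real.pi : ℂ) / (1 / 2)) ^ (1 / 2 : ℂ) = ((√(2 * Real.pi) : ℝ) : ℂ) := by
    rw [Real.sqrt_eq_rpow, Complex.ofReal_cpow (by positivity)]
    push_cast; congr 1; ring
  have h3 : ((√(2 * Real.pi) : ℝ) : ℂ) ≠ 0 := by
    rw [Complex.ofReal_ne_zero]; positivity
  rw [h2]
  push_cast
  rw [show (-(-(y : ℂ)) ^ 2 / (4 * (1 / 2)) : ℂ) = -(y ^ 2 / 2) by ring]
  field_simp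

/-- The Fock states are eigenvectors of the Fourier transform. -/
theorem fourierU_fockS (n : ℕ) : fourierU (fockS n) = ((-Complex.I) ^ n) • fockS n := by
  induction n with
  | zero => simp [fockS, fourierU_vacuum]
  | succ n ih =>
    rw [fockS, map_smul, fourierU_creation, ih, map_smul, smul_smul, smul_smul, smul_smul]
    congr 1; ring

/-- Identifies the eigenvalue of the adjoint of `fourierOp` with that of `fourierU`. -/
theorem conj_phase (n : ℕ) :
    starRingEnd ℂ (Complex.exp (Real.pi * Complex.I * n / 2)) = (-Complex.I) ^ n := by
  rw [← Complex.exp_conj, show starRingEnd ℂ (Real.pi * Complex.I * n / 2) =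
    n * (-(Real.pi / 2 * Complex.I)) by
      simp only [map_div₀, map_mul, Complex.conj_ofReal, Complex.conj_I, map_natCast,
        Complex.conj_ofNat]
      ring, Complex.exp_nat_mul, Complex.exp_neg,
    Complex.exp_pi_div_two_mul_I, Complex.inv_I]

/-! ### Polynomial bounds on the Fock functions -/

/-- The pairing of an `L²` vector with a Fock wave function is an inner product. -/
theorem coe_fockS_eq_inner (f : L2) (n : ℕ) : (f : 𝓢'(ℝ, ℂ)) (fockS n) = ⟪fock n, f⟫_ℂ := by
  rw [Lp.toTemperedDistribution_apply, L2.inner_def]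
  refine integral_congr_ae ?_
  filter_upwards [(fockS n).coeFn_toLp 2 volume] with x hx
  rw [fock, hx, RCLike.inner_apply, conj_fockS, smul_eq_mul, mul_comm]

/-- The operator `T` grows at most polynomially, in `L²` norm, along the Fock states. -/
def PolyBounded (T : 𝓢(ℝ, ℂ) →L[ℂ] 𝓢(ℝ, ℂ)) : Prop :=
  ∃ (C : ℝ) (k : ℕ), 0 ≤ C ∧
    ∀ n, ‖toLpCLM ℂ ℂ 2 (volume : Measure ℝ) (T (fockS n))‖ ≤ C * (n + 1) ^ k

theorem PolyBounded.add {S T : 𝓢(ℝ, ℂ) →L[ℂ] 𝓢(ℝ, ℂ)} (hS : PolyBounded S)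
    (hT : PolyBounded T) : PolyBounded (S + T) := by
  obtain ⟨C, k, hC, h⟩ := hS
  obtain ⟨D, l, hD, h'⟩ := hT
  refine ⟨C + D, k + l, by positivity, fun n => ?_⟩
  rw [add_apply, map_add]
  have h1 : (1 : ℝ) ≤ n + 1 := by linarith [Nat.cast_nonneg (α := ℝ) n]
  have h2 : (n + 1 : ℝ) ^ k ≤ (n + 1) ^ (k + l) := pow_le_pow_right₀ h1 (by omega)
  have h3 : (n + 1 : ℝ) ^ l ≤ (n + 1) ^ (k + l) := pow_le_pow_right₀ h1 (by omega)
  calc _ ≤ _ := norm_add_le _ _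
    _ ≤ C * (n + 1) ^ k + D * (n + 1) ^ l := add_le_add (h n) (h' n)
    _ ≤ C * (n + 1) ^ (k + l) + D * (n + 1) ^ (k + l) := by gcongr
    _ = _ := by ring

theorem PolyBounded.smul {T : 𝓢(ℝ, ℂ) →L[ℂ] 𝓢(ℝ, ℂ)} (c : ℂ) (hT : PolyBounded T) :
    PolyBounded (c • T) := by
  obtain ⟨C, k, hC, h⟩ := hT
  refine ⟨‖c‖ * C, k, by positivity, fun n => ?_⟩
  rw [smul_apply, map_smul, norm_smul, mul_assoc]
  gcongr
  exact h n

theorem sqrt_succ_le (n : ℕ) : √((n : ℝ) + 1) ≤ n + 1 := by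
  have h1 : (1 : ℝ) ≤ n + 1 := by linarith [Nat.cast_nonneg (α := ℝ) n]
  rw [Real.sqrt_le_left (by positivity)]
  nlinarith

/-- `â†` raises the index by one with factor `√(n+1) ≤ n + 1`, and `n + 2 ≤ 2 (n + 1)`; this costs
one power and the constant `2 ^ k`. -/
theorem PolyBounded.comp_creation {T : 𝓢(ℝ, ℂ) →L[ℂ] 𝓢(ℝ, ℂ)} (hT : PolyBounded T) :
    PolyBounded (T ∘L creation) := by
  obtain ⟨C, k, hC, h⟩ := hT
  refine ⟨C * 2 ^ k, k + 1, by positivity, fun n => ?_⟩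
  rw [ContinuousLinearMap.comp_apply, creation_fockS, map_smul, map_smul, norm_smul,
    Complex.norm_real, Real.norm_of_nonneg (Real.sqrt_nonneg _)]
  have h2 := h (n + 1)
  push_cast at h2
  have hn := Nat.cast_nonneg (α := ℝ) n
  calc _ ≤ ((n : ℝ) + 1) * (C * (n + 1 + 1) ^ k) := by
        gcongr
        exact sqrt_succ_le n
    _ ≤ ((n : ℝ) + 1) * (C * (2 * (n + 1)) ^ k) := by
        gcongr; linarith
    _ = _ := by rw [mul_pow]; ring

theorem PolyBounded.comp_annihilation {T : 𝓢(ℝ, ℂ) →L[ℂ] 𝓢(ℝ, ℂ)} (hT : PolyBounded T) :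
    PolyBounded (T ∘L annihilation) := by
  obtain ⟨C, k, hC, h⟩ := hT
  refine ⟨C, k + 1, by positivity, fun n => ?_⟩
  cases n with
  | zero =>
    rw [ContinuousLinearMap.comp_apply, annihilation_fockS_zero, map_zero, map_zero, norm_zero]
    positivity
  | succ n =>
    rw [ContinuousLinearMap.comp_apply, annihilation_fockS_succ, map_smul, map_smul, norm_smul,
      Complex.norm_real, Real.norm_of_nonneg (Real.sqrt_nonneg _)]
    have hn := Nat.cast_nonneg (α := ℝ) n
    push_cast
    calc _ ≤ ((n : ℝ) + 1) * (C * (n + 1) ^ k) := by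
          gcongr
          · exact sqrt_succ_le n
          · exact h n
      _ ≤ ((n : ℝ) + 1 + 1) * (C * (n + 1 + 1) ^ k) := by gcongr <;> linarith
      _ = _ := by ring

theorem PolyBounded.comp_position {T : 𝓢(ℝ, ℂ) →L[ℂ] 𝓢(ℝ, ℂ)} (hT : PolyBounded T) :
    PolyBounded (T ∘L position) := by
  rw [position_eq_ladder, ContinuousLinearMap.comp_smul, ContinuousLinearMap.comp_add]
  exact (hT.comp_annihilation.add hT.comp_creation).smul _

theorem PolyBounded.comp_derivCLM {T : 𝓢(ℝ, ℂ) →L[ℂ] 𝓢(ℝ, ℂ)} (hT : PolyBounded T) :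
    PolyBounded (T ∘L derivCLM ℂ ℂ) := by
  rw [derivCLM_eq_ladder, sub_eq_add_neg, ← neg_one_smul ℂ creation,
    ContinuousLinearMap.comp_smul, ContinuousLinearMap.comp_add, ContinuousLinearMap.comp_smul]
  exact (hT.comp_annihilation.add (hT.comp_creation.smul _)).smul _

theorem polyBounded_id : PolyBounded (ContinuousLinearMap.id ℂ _) :=
  ⟨1, 0, zero_le_one, fun n => by
    have : ‖fock n‖ = 1 := orthonormal_fock.1 n
    change ‖fock n‖ ≤ _
    rw [this, pow_zero, mul_one]⟩

theorem integral_norm_sq_eq (g : 𝓢(ℝ, ℂ)) :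
    ∫ x, ‖g x‖ ^ 2 = ‖toLpCLM ℂ ℂ 2 (volume : Measure ℝ) g‖ ^ 2 := by
  have h : ⟪g.toLp 2 volume, g.toLp 2 volume⟫_ℂ = _ := inner_toL2_toL2_eq g g volume
  rw [inner_self_eq_norm_sq_to_K] at h
  simp only [inner_self_eq_norm_sq_to_K] at h
  have h2 : ∀ x, ((‖g x‖ : ℂ)) ^ 2 = ((‖g x‖ ^ 2 : ℝ) : ℂ) := fun x => by push_cast; rfl
  have h3 : ∫ x, ((‖g x‖ : ℂ)) ^ 2 = ((∫ x, ‖g x‖ ^ 2 : ℝ) : ℂ) := by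
    simp only [h2]; exact integral_complex_ofReal
  rw [toLpCLM_apply]
  refine Complex.ofReal_injective (h3.symm.trans (h.symm.trans ?_))
  push_cast
  rfl

theorem integrable_norm_sq (g : 𝓢(ℝ, ℂ)) : Integrable fun x => ‖g x‖ ^ 2 :=
  (memLp_two_iff_integrable_sq_norm g.continuous.aestronglyMeasurable).1 (g.memLp 2 volume)

/-- The one-dimensional Sobolev inequality for Schwartz functions. -/
theorem norm_sq_apply_le (g : 𝓢(ℝ, ℂ)) (x : ℝ) :
    ‖g x‖ ^ 2 ≤ ‖toLpCLM ℂ ℂ 2 (volume : Measure ℝ) g‖ ^ 2 +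
      ‖toLpCLM ℂ ℂ 2 (volume : Measure ℝ) (derivCLM ℂ ℂ g)‖ ^ 2 := by
  set g' : 𝓢(ℝ, ℂ) := derivCLM ℂ ℂ g with hg'
  have hd : ∀ y, HasDerivAt (fun y => starRingEnd ℂ (g y) * g y)
      (starRingEnd ℂ (g' y) * g y + starRingEnd ℂ (g y) * g' y) y := fun y => by
    have h1 : HasDerivAt (fun y => starRingEnd ℂ (g y)) (starRingEnd ℂ (deriv g y)) y :=
      (Complex.conjCLE : ℂ →L[ℝ] ℂ).hasFDerivAt.comp_hasDerivAt y (g.hasDerivAt y)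
    exact h1.mul (g.hasDerivAt y)
  have hb : ∀ y, ‖starRingEnd ℂ (g' y) * g y + starRingEnd ℂ (g y) * g' y‖ ≤
      ‖g y‖ ^ 2 + ‖g' y‖ ^ 2 := fun y => by
    refine (norm_add_le _ _).trans ?_
    simp only [norm_mul, RCLike.norm_conj]
    nlinarith [sq_nonneg (‖g y‖ - ‖g' y‖)]
  have hi2 := (integrable_norm_sq g).add (integrable_norm_sq g')
  have hi : Integrable fun y => starRingEnd ℂ (g' y) * g y + starRingEnd ℂ (g y) * g' y := by
    refine hi2.mono' ?_ (Filter.Eventually.of_forall hb)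
    have := g.continuous
    have := g'.continuous
    exact Continuous.aestronglyMeasurable (by fun_prop)
  have hlim : Filter.Tendsto (fun y => starRingEnd ℂ (g y) * g y) Filter.atBot (nhds 0) := by
    have h0 : Filter.Tendsto g Filter.atBot (nhds 0) :=
      g.tendsto_cocompact.mono_left _root_.atBot_le_cocompact
    have h1 := ((Complex.continuous_conj.tendsto 0).comp h0).mul h0
    simpa using h1
  -- Fundamental theorem of calculus for `|g|²` on `(-∞, x]`: the boundary term at `-∞` vanishes and
  -- the derivative is at most `|g|² + |g'|²`.
  have h := integral_Iic_of_hasDerivAt_of_tendsto (a := x) (hd x).continuousAt.continuousWithinAt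
    (fun y _ => hd y) hi.integrableOn hlim
  calc ‖g x‖ ^ 2 = ‖starRingEnd ℂ (g x) * g x - 0‖ := by
        rw [sub_zero, norm_mul, RCLike.norm_conj, sq]
    _ ≤ ∫ y in Set.Iic x, ‖starRingEnd ℂ (g' y) * g y + starRingEnd ℂ (g y) * g' y‖ := by
        rw [← h]; exact norm_integral_le_integral_norm _
    _ ≤ ∫ y, ‖starRingEnd ℂ (g' y) * g y + starRingEnd ℂ (g y) * g' y‖ :=
        setIntegral_le_integral hi.norm (Filter.Eventually.of_forall fun _ => norm_nonneg _)
    _ ≤ ∫ y, (‖g y‖ ^ 2 + ‖g' y‖ ^ 2) := integral_mono hi.norm hi2 hb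
    _ = _ := by
        rw [integral_add (integrable_norm_sq g) (integrable_norm_sq g'), integral_norm_sq_eq,
          integral_norm_sq_eq]

/-- The Sobolev inequality turns `L²` growth bounds for the function and its derivative into a
uniform bound. -/
theorem PolyBounded.exists_norm_apply_le {T : 𝓢(ℝ, ℂ) →L[ℂ] 𝓢(ℝ, ℂ)} (hT : PolyBounded T)
    (hT' : PolyBounded (derivCLM ℂ ℂ ∘L T)) :
    ∃ (C : ℝ) (k : ℕ), 0 ≤ C ∧ ∀ n x, ‖T (fockS n) x‖ ≤ C * (n + 1) ^ k := by
  obtain ⟨C, k, hC, h⟩ := hT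
  obtain ⟨D, l, hD, h'⟩ := hT'
  refine ⟨C + D, k + l, by positivity, fun n x => ?_⟩
  have h1 : (1 : ℝ) ≤ n + 1 := by linarith [Nat.cast_nonneg (α := ℝ) n]
  have h2 : (n + 1 : ℝ) ^ k ≤ (n + 1) ^ (k + l) := pow_le_pow_right₀ h1 (by omega)
  have h3 : (n + 1 : ℝ) ^ l ≤ (n + 1) ^ (k + l) := pow_le_pow_right₀ h1 (by omega)
  refine (sq_le_sq₀ (norm_nonneg _) (by positivity)).1 ((norm_sq_apply_le _ x).trans ?_)
  have ha := (h n).trans (mul_le_mul_of_nonneg_left h2 hC)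
  have hb := (h' n).trans (mul_le_mul_of_nonneg_left h3 hD)
  rw [ContinuousLinearMap.comp_apply] at hb
  have ha' := norm_nonneg (toLpCLM ℂ ℂ 2 (volume : Measure ℝ) (T (fockS n)))
  have hb' := norm_nonneg (toLpCLM ℂ ℂ 2 (volume : Measure ℝ) (derivCLM ℂ ℂ (T (fockS n))))
  rw [add_mul]
  nlinarith [pow_le_pow_left₀ ha' ha 2, pow_le_pow_left₀ hb' hb 2,
    mul_nonneg (ha'.trans ha) (hb'.trans hb)]

/-- The Fock wave functions decay quadratically, with a constant polynomial in `n`. -/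
theorem exists_fockS_decay : ∃ (C : ℝ) (k : ℕ), 0 ≤ C ∧
    ∀ n x, (1 + x ^ 2) * ‖fockS n x‖ ≤ C * (n + 1) ^ k := by
  have hi := polyBounded_id
  have hd := hi.comp_derivCLM
  rw [ContinuousLinearMap.id_comp] at hd
  have hp := hi.comp_position.comp_position
  rw [ContinuousLinearMap.id_comp] at hp
  obtain ⟨C, k, hC, h⟩ := hi.exists_norm_apply_le hd
  obtain ⟨D, l, hD, h'⟩ := hp.exists_norm_apply_le hd.comp_position.comp_position
  refine ⟨C + D, k + l, by positivity, fun n x => ?_⟩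
  have h1 : (1 : ℝ) ≤ n + 1 := by linarith [Nat.cast_nonneg (α := ℝ) n]
  have h2 : (n + 1 : ℝ) ^ k ≤ (n + 1) ^ (k + l) := pow_le_pow_right₀ h1 (by omega)
  have h3 : (n + 1 : ℝ) ^ l ≤ (n + 1) ^ (k + l) := pow_le_pow_right₀ h1 (by omega)
  have ha := (h n x).trans (mul_le_mul_of_nonneg_left h2 hC)
  have hb := (h' n x).trans (mul_le_mul_of_nonneg_left h3 hD)
  have e : ‖(position ∘L position) (fockS n) x‖ = x ^ 2 * ‖fockS n x‖ := by
    rw [ContinuousLinearMap.comp_apply, position_apply, position_apply, norm_mul, norm_mul,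
      Complex.norm_real, ← mul_assoc, ← sq, Real.norm_eq_abs, sq_abs]
  rw [e] at hb
  rw [ContinuousLinearMap.id_apply] at ha
  linarith

/-! ### Completeness of the Fock states -/

/-- `q̂` is a combination of `â` and `â†`, each of which moves the Fock index by one. Iterating from
the vacuum puts every `x^m` times the vacuum in the span. -/
theorem position_mem_span_fockS {u : 𝓢(ℝ, ℂ)} (hu : u ∈ Submodule.span ℂ (Set.range fockS)) :
    position u ∈ Submodule.span ℂ (Set.range fockS) := by
  have hm : ∀ n, fockS n ∈ Submodule.span ℂ (Set.range fockS) := fun n =>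
    Submodule.subset_span ⟨n, rfl⟩
  induction hu using Submodule.span_induction with
  | mem v hv =>
    obtain ⟨n, rfl⟩ := hv
    rw [position_eq_ladder, smul_apply, add_apply, creation_fockS]
    refine Submodule.smul_mem _ _ (Submodule.add_mem _ ?_ (Submodule.smul_mem _ _ (hm _)))
    cases n with
    | zero => rw [annihilation_fockS_zero]; exact Submodule.zero_mem _
    | succ n => rw [annihilation_fockS_succ]; exact Submodule.smul_mem _ _ (hm _)
  | zero => rw [map_zero]; exact Submodule.zero_mem _
  | add v w _ _ hv hw => rw [map_add]; exact Submodule.add_mem _ hv hw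
  | smul c v _ hv => rw [map_smul]; exact Submodule.smul_mem _ _ hv

/-- The moments, against the vacuum, of a vector orthogonal to all Fock states vanish. -/
theorem integral_pow_mul_vacuum_eq_zero {f : L2} (hf : ∀ n, ⟪fock n, f⟫_ℂ = 0) (m : ℕ) :
    ∫ x : ℝ, (x : ℂ) ^ m * (vacuum x * f x) = 0 := by
  have h1 : ∀ u ∈ Submodule.span ℂ (Set.range fockS), (f : 𝓢'(ℝ, ℂ)) u = 0 := fun u hu => by
    induction hu using Submodule.span_induction with
    | mem v hv => obtain ⟨n, rfl⟩ := hv; rw [coe_fockS_eq_inner, hf]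
    | zero => exact map_zero _
    | add v w _ _ hv hw => rw [map_add, hv, hw, add_zero]
    | smul c v _ hv => rw [map_smul, hv, smul_zero]
  have h2 : ∀ m : ℕ, ∃ u ∈ Submodule.span ℂ (Set.range fockS),
      ∀ x : ℝ, u x = (x : ℂ) ^ m * vacuum x := fun m => by
    induction m with
    | zero => exact ⟨fockS 0, Submodule.subset_span ⟨0, rfl⟩, fun x => by simp [fockS]⟩
    | succ m ih =>
      obtain ⟨u, hu, h⟩ := ih
      exact ⟨position u, position_mem_span_fockS hu, fun x => by rw [position_apply, h]; ring⟩
  obtain ⟨u, hu, h⟩ := h2 m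
  have h3 := h1 u hu
  rw [Lp.toTemperedDistribution_apply] at h3
  rw [← h3]
  simp only [h, smul_eq_mul, mul_assoc]

theorem integrable_exp_mul_vacuum_mul (f : L2) (c : ℝ) :
    Integrable fun x : ℝ => Real.exp (c * |x|) * ‖vacuum x * f x‖ := by
  have h1 : MemLp (fun x : ℝ => Real.exp (c * |x|) * ‖vacuum x‖) 2 volume := by
    have hm : AEStronglyMeasurable (fun x : ℝ => Real.exp (c * |x|) * ‖vacuum x‖) volume := by
      have := vacuum.continuous
      exact Continuous.aestronglyMeasurable (by fun_prop)
    rw [memLp_two_iff_integrable_sq hm]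
    -- Completing the square, `2c|x| - x² ≤ 2c² - x²/2`, bounds the square by a Gaussian; the
    -- product with `f` is then integrable by Hölder.
    have hg := (integrable_exp_neg_mul_sq (b := 1 / 2) (by norm_num)).const_mul
      ((Real.pi ^ (-(1 / 4) : ℝ)) ^ 2 * Real.exp (2 * c ^ 2))
    refine hg.mono' (hm.pow 2) (Filter.Eventually.of_forall fun x => ?_)
    rw [vacuum_apply, Complex.norm_real, Real.norm_of_nonneg (by positivity),
      Real.norm_of_nonneg (by positivity), mul_pow, mul_pow, ← Real.exp_nat_mul, ← Real.exp_nat_mul,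
      mul_left_comm, mul_assoc, ← Real.exp_add, ← Real.exp_add]
    refine mul_le_mul_of_nonneg_left (Real.exp_le_exp.2 ?_) (by positivity)
    push_cast
    nlinarith [sq_nonneg (|x| - 2 * c), sq_abs x]
  have h2 := h1.integrable_mul (Lp.memLp f).norm
  refine h2.congr (Filter.Eventually.of_forall fun x => ?_)
  simp [mul_assoc]

/-- Expand the exponential: the series is dominated by `exp (|c| |x|)` times the integrand, and all
its terms are vanishing moments. -/
theorem integral_exp_mul_vacuum_eq_zero {f : L2} (hf : ∀ n, ⟪fock n, f⟫_ℂ = 0) (c : ℂ) :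
    ∫ x : ℝ, Complex.exp (c * x) * (vacuum x * f x) = 0 := by
  have hmeas : AEStronglyMeasurable (fun x => vacuum x * f x) volume :=
    vacuum.continuous.aestronglyMeasurable.mul (Lp.memLp f).1
  have h := hasSum_integral_of_dominated_convergence (μ := volume)
    (F := fun (m : ℕ) (x : ℝ) => (c * x) ^ m / m ! * (vacuum x * f x))
    (f := fun x : ℝ => Complex.exp (c * x) * (vacuum x * f x))
    (fun m x => (‖c‖ * |x|) ^ m / m ! * ‖vacuum x * f x‖)
    (fun m => by
      refine AEStronglyMeasurable.mul (Continuous.aestronglyMeasurable ?_) hmeas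
      fun_prop)
    (fun m => Filter.Eventually.of_forall fun x => by
      rw [norm_mul, norm_div, norm_pow, norm_mul, Complex.norm_real, Complex.norm_natCast,
        Real.norm_eq_abs])
    (Filter.Eventually.of_forall fun x => (Real.summable_pow_div_factorial _).mul_right _)
    (by
      refine (integrable_exp_mul_vacuum_mul f ‖c‖).congr (Filter.Eventually.of_forall fun x => ?_)
      simp only
      rw [tsum_mul_right, Real.exp_eq_exp_ℝ, NormedSpace.exp_eq_tsum_div])
    (Filter.Eventually.of_forall fun x => by
      refine HasSum.mul_right _ ?_
      rw [Complex.exp_eq_exp_ℂ]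
      exact NormedSpace.expSeries_div_hasSum_exp _)
  refine h.unique ?_
  have e : ∀ m : ℕ, ∫ x : ℝ, (c * x) ^ m / m ! * (vacuum x * f x) = 0 := fun m => by
    have e2 : ∀ x : ℝ, (c * x) ^ m / m ! * (vacuum x * f x) =
        (c ^ m / m !) * ((x : ℂ) ^ m * (vacuum x * f x)) := fun x => by rw [mul_pow]; ring
    simp only [e2]
    rw [integral_const_mul, integral_pow_mul_vacuum_eq_zero hf, mul_zero]
  simp only [e]
  exact hasSum_zero

/-- Completeness of the Fock states. -/
theorem eq_zero_of_inner_fock {f : L2} (hf : ∀ n, ⟪fock n, f⟫_ℂ = 0) : f = 0 := by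
  set h : ℝ → ℂ := fun x => vacuum x * f x with hh
  have hint : Integrable h := by
    have h0 := integrable_exp_mul_vacuum_mul f 0
    simp only [zero_mul, Real.exp_zero, one_mul] at h0
    exact (integrable_norm_iff
      (vacuum.continuous.aestronglyMeasurable.mul (Lp.memLp f).1)).1 h0
  -- At `c = -2πiw` the exponential moment is the Fourier transform of `vacuum * f` at `w`.
  have hF : FourierTransform.fourier h = 0 := by
    ext w
    rw [Real.fourier_real_eq_integral_exp_smul]
    have := integral_exp_mul_vacuum_eq_zero hf (-2 * Real.pi * w * Complex.I)
    rw [Pi.zero_apply, ← this]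
    refine integral_congr_ae (Filter.Eventually.of_forall fun x => ?_)
    simp only [smul_eq_mul, hh]
    congr 2
    push_cast; ring
  -- Moving the Fourier transform across the pairing, from the inverse transform of `ψ` onto `h`,
  -- gives zero. Hence `h` vanishes as a distribution, then almost everywhere, and so does `f`
  -- because the vacuum has no zeros.
  have hpair : ∀ ψ : 𝓢(ℝ, ℂ), ∫ x, h x * ψ x = 0 := fun ψ => by
    have h1 := VectorFourier.integral_bilin_fourierIntegral_eq_flip (ContinuousLinearMap.mul ℂ ℂ)
      (L := innerₗ ℝ) (μ := volume) (ν := volume) Real.continuous_fourierChar continuous_inner hint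
      (FourierTransform.fourierInv ψ : 𝓢(ℝ, ℂ)).integrable
    have h2 : FourierTransform.fourier ((FourierTransform.fourierInv ψ : 𝓢(ℝ, ℂ)) : ℝ → ℂ) = ψ := by
      rw [← fourier_coe, FourierTransform.fourier_fourierInv_eq]
    have h3 : VectorFourier.fourierIntegral Real.fourierChar volume (innerₗ ℝ) h = 0 := hF
    have h4 : VectorFourier.fourierIntegral Real.fourierChar volume (innerₗ ℝ).flip
        (FourierTransform.fourierInv ψ : 𝓢(ℝ, ℂ)) = ψ := by
      rw [flip_innerₗ]; exact h2
    rw [h3, h4] at h1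
    simpa using h1.symm
  have h0 : ∀ᵐ x, h x = 0 := by
    refine ae_eq_zero_of_integral_contDiff_smul_eq_zero hint.locallyIntegrable fun g hg hgc => ?_
    have hg₁ : HasCompactSupport (Complex.ofRealCLM ∘ g) := hgc.comp_left rfl
    have hg₂ : ContDiff ℝ ∞ (Complex.ofRealCLM ∘ g) := by fun_prop
    rw [← hpair (hg₁.toSchwartzMap hg₂)]
    refine integral_congr_ae (Filter.Eventually.of_forall fun x => ?_)
    simp [mul_comm]
  rw [Lp.eq_zero_iff_ae_eq_zero]
  filter_upwards [h0] with x hx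
  refine (mul_eq_zero.1 hx).resolve_left ?_
  rw [vacuum_apply, Complex.ofReal_eq_zero]
  positivity

theorem ext_inner_fock {f g : L2} (h : ∀ n, ⟪fock n, f⟫_ℂ = ⟪fock n, g⟫_ℂ) : f = g :=
  sub_eq_zero.1 (eq_zero_of_inner_fock fun n => by rw [inner_sub_right, h, sub_self])

theorem inner_fock_of_hasSum {c : ℕ → ℂ} {f : L2} (h : HasSum (fun n => c n • fock n) f) (n : ℕ) :
    ⟪fock n, f⟫_ℂ = c n := by
  have h1 := h.mapL (innerSL ℂ (fock n))
  simp only [innerSL_apply_apply, inner_smul_right,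
    orthonormal_iff_ite.1 orthonormal_fock] at h1
  refine h1.unique ?_
  have := hasSum_ite_eq n (c n)
  refine this.congr_fun fun m => ?_
  by_cases hm : m = n
  · simp [hm]
  · simp [hm, Ne.symm hm]

/-! ### The Fourier operator on Fock coefficients -/

theorem inner_fock_fourierOp (f : L2) (n : ℕ) :
    ⟪fock n, fourierOp f⟫_ℂ = Complex.exp (Real.pi * Complex.I * n / 2) * ⟪fock n, f⟫_ℂ :=
  inner_fock_of_hasSum (summable_phase f).hasSum n

theorem fourierOp_fock (n : ℕ) :
    fourierOp (fock n) = Complex.exp (Real.pi * Complex.I * n / 2) • fock n := by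
  refine ext_inner_fock fun m => ?_
  rw [inner_fock_fourierOp, inner_smul_right, orthonormal_iff_ite.1 orthonormal_fock]
  split_ifs with h
  · rw [h]
  · simp

theorem inner_fock_adjoint_fourierOp (f : L2) (n : ℕ) :
    ⟪fock n, ContinuousLinearMap.adjoint fourierOp f⟫_ℂ = (-Complex.I) ^ n * ⟪fock n, f⟫_ℂ := by
  rw [ContinuousLinearMap.adjoint_inner_right, fourierOp_fock, inner_smul_left, conj_phase]

theorem neg_I_pow_mul_phase (n : ℕ) :
    (-Complex.I) ^ n * Complex.exp (Real.pi * Complex.I * n / 2) = 1 := by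
  rw [← conj_phase, ← Complex.normSq_eq_conj_mul_self, Complex.normSq_eq_norm_sq, norm_phase]
  norm_num

theorem fourierOp_adjoint_fourierOp (f : L2) :
    fourierOp (ContinuousLinearMap.adjoint fourierOp f) = f :=
  ext_inner_fock fun n => by
    rw [inner_fock_fourierOp, inner_fock_adjoint_fourierOp, ← mul_assoc, mul_comm (Complex.exp _),
      neg_I_pow_mul_phase, one_mul]

/-! ### Dirac combs as tempered distributions -/

theorem alpha_pos {d : ℕ} (hd : 0 < d) : 0 < alpha d := by
  have : (0 : ℝ) < d := by exact_mod_cast hd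
  exact Real.sqrt_pos.2 (by positivity)

theorem alpha_sq_mul {d : ℕ} (hd : 0 < d) : alpha d * alpha d * d = 2 * Real.pi := by
  have : (0 : ℝ) < d := by exact_mod_cast hd
  rw [alpha, Real.mul_self_sqrt (by positivity)]
  field_simp

theorem summable_inv_one_add_sq_affine {a : ℝ} (ha : a ≠ 0) (b : ℝ) :
    Summable fun s : ℤ => (1 + (a * s + b) ^ 2)⁻¹ := by
  have h := (Real.summable_one_div_int_add_rpow (1 / 2) 2).2 one_lt_two
  -- From `s + 1/2 = (a s + b) / a + (1/2 - b/a)` and `(p + q)² ≤ 2p² + 2q²` one gets `(s + 1/2)² ≤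
  -- C (1 + (a s + b)²)`. The offset `1/2` keeps the comparison series free of a zero denominator.
  set C := 2 / a ^ 2 + 2 * (1 / 2 - b / a) ^ 2 with hC
  refine (h.mul_left C).of_nonneg_of_le (fun s => by positivity) fun s => ?_
  have h2 : ((s : ℝ) + 1 / 2) ≠ 0 := fun h0 => by
    have : (2 * s + 1 : ℤ) = 0 := by
      have : ((2 * s + 1 : ℤ) : ℝ) = 0 := by push_cast; linarith
      exact_mod_cast this
    omega
  have h3 : (0 : ℝ) < |(s : ℝ) + 1 / 2| ^ (2 : ℝ) := by positivity
  rw [inv_le_comm₀ (by positivity) (by positivity), mul_inv, one_div, inv_inv, ← div_eq_inv_mul,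
    div_le_iff₀ (by positivity)]
  norm_cast
  rw [sq_abs]
  have e : (s : ℝ) + 1 / 2 = (a * s + b) / a + (1 / 2 - b / a) := by field_simp; ring
  have e2 : ((a * s + b) / a) ^ 2 = (a * s + b) ^ 2 * (1 / a ^ 2) := by rw [div_pow]; ring
  have e3 : C = 2 * (1 / a ^ 2) + 2 * (1 / 2 - b / a) ^ 2 := by rw [hC]; ring
  have e4 : 0 < 1 / a ^ 2 := by positivity
  rw [e, e3]
  nlinarith [sq_nonneg ((a * s + b) / a - (1 / 2 - b / a)),
    mul_nonneg (sq_nonneg (a * s + b)) (sq_nonneg (1 / 2 - b / a))]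

/-- The position `α_d (d s + j)` of a tooth of the Dirac comb of `|j_ideal⟩`. -/
def node (d : ℕ) (j : Fin d) (s : ℤ) : ℝ := alpha d * (d * s + (j : ℕ))

theorem summable_node {d : ℕ} (j : Fin d) : Summable fun s : ℤ => (1 + node d j s ^ 2)⁻¹ := by
  have hd : 0 < d := j.pos
  have : (d : ℝ) ≠ 0 := by exact_mod_cast hd.ne'
  refine (summable_inv_one_add_sq_affine (mul_ne_zero (alpha_pos hd).ne' this)
    (alpha d * (j : ℕ))).congr fun s => ?_
  rw [node]; ring_nf

theorem one_add_sq_mul_norm_le (u : 𝓢(ℝ, ℂ)) (x : ℝ) :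
    (1 + x ^ 2) * ‖u x‖ ≤ SchwartzMap.seminorm ℂ 0 0 u + SchwartzMap.seminorm ℂ 2 0 u := by
  have h1 := norm_le_seminorm ℂ u x
  have h2 := norm_pow_mul_le_seminorm ℂ u 2 x
  rw [Real.norm_eq_abs, sq_abs] at h2
  linarith

theorem norm_le_inv_one_add_sq {u : 𝓢(ℝ, ℂ)} {C : ℝ} (hC : ∀ x, (1 + x ^ 2) * ‖u x‖ ≤ C) (x : ℝ) :
    ‖u x‖ ≤ C * (1 + x ^ 2)⁻¹ := by
  rw [← div_eq_mul_inv, le_div_iff₀ (by positivity), mul_comm]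
  exact hC x

theorem summable_norm_comp {y : ℤ → ℝ} (hy : Summable fun s => (1 + y s ^ 2)⁻¹) (u : 𝓢(ℝ, ℂ)) :
    Summable fun s => ‖u (y s)‖ :=
  (hy.mul_left _).of_nonneg_of_le (fun _ => norm_nonneg _) fun s =>
    norm_le_inv_one_add_sq (one_add_sq_mul_norm_le u) (y s)

theorem norm_tsum_comp_le {y : ℤ → ℝ} (hy : Summable fun s => (1 + y s ^ 2)⁻¹) {u : 𝓢(ℝ, ℂ)} {C : ℝ}
    (hC : ∀ x, (1 + x ^ 2) * ‖u x‖ ≤ C) :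
    ‖∑' s, u (y s)‖ ≤ C * ∑' s, (1 + y s ^ 2)⁻¹ := by
  rw [← tsum_mul_left]
  exact tsum_of_norm_bounded (hy.mul_left C).hasSum fun s => norm_le_inv_one_add_sq hC (y s)

/-- The Dirac comb with teeth at `y s`. -/
def comb (y : ℤ → ℝ) (hy : Summable fun s => (1 + y s ^ 2)⁻¹) : 𝓢(ℝ, ℂ) →L[ℂ] ℂ :=
  mkCLMtoNormedSpace (fun u => ∑' s, u (y s))
    (fun u v => by
      simp only [add_apply]
      exact (summable_norm_comp hy u).of_norm.tsum_add (summable_norm_comp hy v).of_norm)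
    (fun a u => by simp [tsum_mul_left])
    ⟨{(0, 0), (2, 0)}, 2 * ∑' s, (1 + y s ^ 2)⁻¹,
      mul_nonneg two_pos.le (tsum_nonneg fun s => by positivity), fun u => by
      refine (norm_tsum_comp_le hy (one_add_sq_mul_norm_le u)).trans ?_
      rw [mul_right_comm]
      refine mul_le_mul_of_nonneg_right ?_ (tsum_nonneg fun s => by positivity)
      have h : ∀ p ∈ ({(0, 0), (2, 0)} : Finset (ℕ × ℕ)), SchwartzMap.seminorm ℂ p.1 p.2 u ≤
          (({(0, 0), (2, 0)} : Finset (ℕ × ℕ)).sup (schwartzSeminormFamily ℂ ℝ ℂ)) u :=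
        fun p hp => Seminorm.le_def.1
          (Finset.le_sup (f := schwartzSeminormFamily ℂ ℝ ℂ) hp) u
      have h1 := h (0, 0) (by simp)
      have h2 := h (2, 0) (by simp)
      simp only at h1 h2
      linarith⟩

/-- Guarantees that the `tsum` defining `idealState` is the genuine comb and not the default value
of a divergent sum. -/
theorem hasSum_delta {y : ℤ → ℝ} (hy : Summable fun s => (1 + y s ^ 2)⁻¹) :
    HasSum (fun s => (TemperedDistribution.delta (y s) : 𝓢'(ℝ, ℂ)))
      (ContinuousLinearMap.toPointwiseConvergenceCLM _ _ _ _ (comb y hy)) := by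
  refine PointwiseConvergenceCLM.tendsto_iff_forall_tendsto.2 fun u => ?_
  have h : HasSum (fun s => u (y s)) (∑' s, u (y s)) := (summable_norm_comp hy u).of_norm.hasSum
  refine Filter.Tendsto.congr (fun t => ?_) h
  simp

theorem idealState_apply {d : ℕ} (j : Fin d) (u : 𝓢(ℝ, ℂ)) :
    idealState d j u = ((√(alpha d * d) : ℝ) : ℂ) * ∑' s : ℤ, u (node d j s) := by
  have h := (hasSum_delta (summable_node j)).tsum_eq
  simp only [node] at h
  rw [idealState, h]
  rfl

theorem norm_idealState_le {d : ℕ} (j : Fin d) {u : 𝓢(ℝ, ℂ)} {C : ℝ}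
    (hC : ∀ x, (1 + x ^ 2) * ‖u x‖ ≤ C) :
    ‖idealState d j u‖ ≤ √(alpha d * d) * (C * ∑' s, (1 + node d j s ^ 2)⁻¹) := by
  rw [idealState_apply, norm_mul, Complex.norm_real, Real.norm_of_nonneg (Real.sqrt_nonneg _)]
  exact mul_le_mul_of_nonneg_left (norm_tsum_comp_le (summable_node j) hC) (Real.sqrt_nonneg _)

/-! ### Poisson summation and the discrete Fourier transform -/

/-- The phase `exp (-2π i j m / d)`. -/
def dftPhase (d : ℕ) (j : ℕ) (m : ℤ) : ℂ :=
  Complex.exp (-(2 * Real.pi * Complex.I * j * m / d))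

theorem norm_dftPhase (d j : ℕ) (m : ℤ) : ‖dftPhase d j m‖ = 1 := by
  rw [dftPhase, show (-(2 * Real.pi * Complex.I * j * m / d) : ℂ) =
    ((-(2 * Real.pi * j * m / d) : ℝ) : ℂ) * Complex.I by push_cast; ring]
  exact Complex.norm_exp_ofReal_mul_I _

theorem dftPhase_ne_zero (d j : ℕ) (m : ℤ) : dftPhase d j m ≠ 0 := Complex.exp_ne_zero _

theorem dftPhase_add (d j : ℕ) (m n : ℤ) :
    dftPhase d j (m + n) = dftPhase d j m * dftPhase d j n := by
  rw [dftPhase, dftPhase, dftPhase, ← Complex.exp_add]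
  congr 1; push_cast; ring

theorem dftPhase_mul_add {d : ℕ} (hd : 0 < d) (j : ℕ) (s : ℤ) (k : ℕ) :
    dftPhase d j (s * d + k) = dftPhase d j k := by
  have h : dftPhase d j (s * d) = 1 := by
    rw [dftPhase, Complex.exp_eq_one_iff]
    have : (d : ℂ) ≠ 0 := by exact_mod_cast hd.ne'
    refine ⟨-(j * s), ?_⟩
    push_cast
    field_simp
  rw [dftPhase_add, h, one_mul]

theorem dftCoeff_eq (d : ℕ) (j k : Fin d) :
    dftCoeff d j k = dftPhase d j (k : ℕ) / ((√d : ℝ) : ℂ) := by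
  rw [dftCoeff, dftPhase]; push_cast; rfl

/-- Splitting a sum over `ℤ` into residue classes modulo `d`. -/
theorem sum_dftPhase_mul_tsum {d : ℕ} (hd : 0 < d) (j : ℕ) {F : ℝ → ℂ}
    (hF : Summable fun m : ℤ => ‖F (alpha d * m)‖) :
    ∑ k : Fin d, dftPhase d j (k : ℕ) * ∑' s : ℤ, F (node d k s) =
      ∑' m : ℤ, dftPhase d j m * F (alpha d * m) := by
  have : NeZero d := ⟨hd.ne'⟩
  obtain ⟨e, he⟩ : ∃ e : Fin d × ℤ ≃ ℤ, ∀ k s, e (k, s) = s * d + (k : ℕ) :=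
    ⟨(Equiv.prodComm _ _).trans (Int.divModEquiv d).symm, fun k s => by simp⟩
  have hs : Summable fun m : ℤ => dftPhase d j m * F (alpha d * m) := by
    refine Summable.of_norm ?_
    simpa only [norm_mul, norm_dftPhase, one_mul] using hF
  have hs' : Summable fun p : Fin d × ℤ => dftPhase d j (e p) * F (alpha d * (e p : ℤ)) :=
    e.summable_iff.2 hs
  rw [← e.tsum_eq, hs'.tsum_prod, tsum_fintype]
  refine Finset.sum_congr rfl fun k _ => ?_
  rw [← tsum_mul_left]
  refine tsum_congr fun s => ?_
  rw [he, dftPhase_mul_add hd, node]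
  push_cast
  rw [mul_comm (s : ℝ)]

theorem summable_lattice {d : ℕ} (hd : 0 < d) :
    Summable fun m : ℤ => (1 + (alpha d * m) ^ 2)⁻¹ := by
  simpa using summable_inv_one_add_sq_affine (alpha_pos hd).ne' 0

theorem fourier_fourier_apply (v : 𝓢(ℝ, ℂ)) (x : ℝ) :
    FourierTransform.fourier (FourierTransform.fourier v) x = v (-x) := by
  have h := congrArg (fun g : 𝓢(ℝ, ℂ) => g (-x)) (FourierTransform.fourierInv_fourier_eq (F := 𝓢(ℝ, ℂ)) v)
  rw [← h, fourierInv_apply_eq]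
  simp

/-- Poisson summation applied to the transform of `v`: transforming twice reflects the argument,
which is absorbed by `m ↦ -m`. -/
theorem tsum_fourier_eq (v : 𝓢(ℝ, ℂ)) (x : ℝ) :
    ∑' s : ℤ, FourierTransform.fourier (v : ℝ → ℂ) (x + s) =
      ∑' m : ℤ, Complex.exp (-(2 * Real.pi * Complex.I * m * x)) * v m := by
  have h := SchwartzMap.tsum_eq_tsum_fourier (FourierTransform.fourier v) x
  rw [fourier_coe] at h
  rw [h, ← (Equiv.neg ℤ).tsum_eq]
  refine tsum_congr fun m => ?_
  rw [fourier_fourier_apply, fourier_coe_apply, mul_comm]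
  simp

theorem fourier_comp_mul {a : ℝ} (ha : 0 < a) (f : ℝ → ℂ) (w : ℝ) :
    FourierTransform.fourier (fun x => f (a * x)) w =
      (a : ℂ)⁻¹ * FourierTransform.fourier f (w / a) := by
  rw [Real.fourier_real_eq_integral_exp_smul, Real.fourier_real_eq_integral_exp_smul]
  have h := Measure.integral_comp_mul_left
    (fun x : ℝ => Complex.exp ((-2 * Real.pi * x * (w / a) : ℝ) * Complex.I) • f x) a
  rw [abs_of_pos (inv_pos.2 ha), Complex.real_smul, Complex.ofReal_inv] at h
  rw [← h]
  refine integral_congr_ae (Filter.Eventually.of_forall fun x => ?_)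
  simp only
  congr 4
  field_simp

/-- Poisson summation: the Fourier transform acts on the ideal code states as a discrete Fourier
transform. -/
theorem idealState_fourierU {d : ℕ} (j : Fin d) (u : 𝓢(ℝ, ℂ)) :
    idealState d j (fourierU u) = ∑ k, dftCoeff d j k * idealState d k u := by
  have hd : 0 < d := j.pos
  have hd' : (0 : ℝ) < d := by exact_mod_cast hd
  have ha := alpha_pos hd
  have h2 := alpha_sq_mul hd
  -- Rescaling by `α_d` turns the lattice `α_d ℤ` into `ℤ`.
  let v : 𝓢(ℝ, ℂ) := compCLMOfContinuousLinearEquiv ℂ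
    (ContinuousLinearEquiv.unitsEquivAut ℝ (Units.mk0 (alpha d) ha.ne')) u
  have hv : ∀ x, v x = u (alpha d * x) := fun x => by simp [v, mul_comm]
  have hR : ∑ k, dftCoeff d j k * idealState d k u = ((√(alpha d * d) : ℝ) : ℂ) / ((√d : ℝ) : ℂ) *
      ∑' m : ℤ, dftPhase d j m * u (alpha d * m) := by
    rw [← sum_dftPhase_mul_tsum hd j (summable_norm_comp (summable_lattice hd) u), Finset.mul_sum]
    refine Finset.sum_congr rfl fun k _ => ?_
    rw [dftCoeff_eq, idealState_apply]
    ring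
  -- Because `α_d² d = 2π`, the frequency `node d j s / (2π)` is `(j/d + s) / α_d`, so the comb
  -- becomes a Poisson sum shifted by `j/d`.
  have hL : ∀ s : ℤ, fourierU u (node d j s) = ((√(2 * Real.pi) : ℝ) : ℂ)⁻¹ * ((alpha d : ℂ) *
      FourierTransform.fourier (v : ℝ → ℂ) (((j : ℕ) : ℝ) / d + s)) := fun s => by
    rw [fourierU_apply_eq_fourier, funext hv, fourier_comp_mul ha, ← mul_assoc (alpha d : ℂ),
      mul_inv_cancel₀ (by exact_mod_cast ha.ne'), one_mul]
    congr 2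
    rw [node, ← h2]
    field_simp
    ring_nf
  rw [hR, idealState_apply]
  simp only [hL]
  rw [tsum_mul_left, tsum_mul_left, tsum_fourier_eq, ← mul_assoc, ← mul_assoc]
  congr 1
  · have e : √(2 * Real.pi) = alpha d * √d := by
      rw [← h2, Real.sqrt_mul (by positivity), Real.sqrt_mul_self ha.le]
    have h3 : ((√d : ℝ) : ℂ) ≠ 0 := by
      rw [Complex.ofReal_ne_zero]; positivity
    have h4 : (alpha d : ℂ) ≠ 0 := by exact_mod_cast ha.ne'
    rw [e]
    push_cast
    field_simp
  · refine tsum_congr fun m => ?_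
    rw [hv, dftPhase]
    congr 2
    push_cast; ring

/-! ### Approximation 3: damped combs -/

/-- The Fourier relation between normalized states is the one between unnormalized states. -/
theorem adjoint_fourierOp_normalized_iff {d : ℕ} {v w : Fin d → L2} (hw : ∀ k, w k ≠ 0)
    (j : Fin d) (hv : v j ≠ 0) :
    (((√(‖v j‖ ^ 2))⁻¹ : ℝ) : ℂ) • ContinuousLinearMap.adjoint fourierOp (v j) =
        ∑ k, (dftCoeff d j k * ((√(‖w k‖ ^ 2 / ‖v j‖ ^ 2) : ℝ) : ℂ)) •
          (((√(‖w k‖ ^ 2))⁻¹ : ℝ) : ℂ) • w k ↔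
      ContinuousLinearMap.adjoint fourierOp (v j) = ∑ k, dftCoeff d j k • w k := by
  have h0 : ((‖v j‖⁻¹ : ℝ) : ℂ) ≠ 0 := by
    rw [Complex.ofReal_ne_zero]; exact inv_ne_zero (norm_ne_zero_iff.2 hv)
  -- The square root contributes `‖w k‖ / ‖v j‖`, which cancels the normalization of `w k` and
  -- leaves the common factor `‖v j‖⁻¹`.
  have h : ∑ k, (dftCoeff d j k * ((√(‖w k‖ ^ 2 / ‖v j‖ ^ 2) : ℝ) : ℂ)) •
      (((√(‖w k‖ ^ 2))⁻¹ : ℝ) : ℂ) • w k = ((‖v j‖⁻¹ : ℝ) : ℂ) • ∑ k, dftCoeff d j k • w k := by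
    rw [Finset.smul_sum]
    refine Finset.sum_congr rfl fun k _ => ?_
    rw [smul_smul, smul_smul, ← div_pow, Real.sqrt_sq (by positivity), Real.sqrt_sq (norm_nonneg _)]
    congr 1
    have h1 : (‖w k‖ : ℂ) ≠ 0 := by
      rw [Complex.ofReal_ne_zero]; exact norm_ne_zero_iff.2 (hw k)
    push_cast
    field_simp
  rw [h, Real.sqrt_sq (norm_nonneg _)]
  exact ⟨fun h => smul_right_injective _ h0 h, fun h => by rw [h]⟩

/-- The coefficient of `exp (-β (n̂ + 1/2)) |j_ideal⟩` along the `n`-th Fock state. -/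
def approx3Coeff (d : ℕ) (β : ℝ) (j : Fin d) (n : ℕ) : ℂ :=
  ((Real.exp (-β * (n + 1 / 2)) : ℝ) : ℂ) * idealState d j (fockS n)

/-- The comb's Fock coefficients grow at most polynomially in `n`, so the exponential damping makes
the series absolutely convergent. -/
theorem summable_approx3 {d : ℕ} {β : ℝ} (hβ : 0 < β) (j : Fin d) :
    Summable fun n : ℕ => approx3Coeff d β j n • fock n := by
  obtain ⟨C, k, hC, h⟩ := exists_fockS_decay
  refine Summable.of_norm ?_
  -- The growth bound is in powers of `n + 1`; writing `-β (n + 1/2) = β/2 - β (n + 1)` accounts for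
  -- the factor `exp (β/2)` below.
  have hs := (summable_nat_add_iff 1).2 (Real.summable_pow_mul_exp_neg_nat_mul k hβ)
  set A : ℝ := √(alpha d * d) * (C * ∑' s, (1 + node d j s ^ 2)⁻¹) with hA
  have hA0 : 0 ≤ A := mul_nonneg (Real.sqrt_nonneg _)
    (mul_nonneg hC (tsum_nonneg fun s => by positivity))
  refine (hs.mul_left (Real.exp (β / 2) * A)).of_nonneg_of_le (fun n => norm_nonneg _) fun n => ?_
  have hn : ‖fock n‖ = 1 := orthonormal_fock.1 n
  rw [norm_smul, hn, mul_one, approx3Coeff, norm_mul, Complex.norm_real, Real.norm_eq_abs,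
    Real.abs_exp]
  have h1 := norm_idealState_le j (h n)
  have h2 : Real.exp (-β * (n + 1 / 2)) = Real.exp (β / 2) * Real.exp (-β * ((n + 1 : ℕ) : ℝ)) := by
    rw [← Real.exp_add]; congr 1; push_cast; ring
  calc _ ≤ Real.exp (-β * (n + 1 / 2)) * (√(alpha d * d) *
        (C * (n + 1) ^ k * ∑' s, (1 + node d j s ^ 2)⁻¹)) := by gcongr
    _ = _ := by rw [h2, hA]; push_cast; ring

theorem inner_fock_approx3Vec {d : ℕ} {β : ℝ} (hβ : 0 < β) (j : Fin d) (n : ℕ) :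
    ⟪fock n, approx3Vec d β j⟫_ℂ = approx3Coeff d β j n :=
  inner_fock_of_hasSum (summable_approx3 hβ j).hasSum n

theorem tsum_ofReal_ne_zero {f : ℤ → ℝ} (hf : ∀ s, 0 < f s) (hs : Summable f) :
    ∑' s, ((f s : ℝ) : ℂ) ≠ 0 := by
  rw [← Complex.ofReal_tsum, Complex.ofReal_ne_zero]
  exact (hs.tsum_pos (fun s => (hf s).le) 0 (hf 0)).ne'

theorem sqrt_alpha_mul_ne_zero {d : ℕ} (hd : 0 < d) : ((√(alpha d * d) : ℝ) : ℂ) ≠ 0 := by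
  rw [Complex.ofReal_ne_zero]
  have := alpha_pos hd
  have : (0 : ℝ) < d := by exact_mod_cast hd
  positivity

/-- The pairing is a positive multiple of a sum of positive Gaussian values, so the damped state has
a nonzero vacuum component. -/
theorem idealState_vacuum_ne_zero {d : ℕ} (j : Fin d) : idealState d j vacuum ≠ 0 := by
  rw [idealState_apply]
  refine mul_ne_zero (sqrt_alpha_mul_ne_zero j.pos) ?_
  have h := summable_norm_comp (summable_node j) vacuum
  simp only [vacuum_apply, Complex.norm_real] at h ⊢
  exact tsum_ofReal_ne_zero (fun s => by positivity) h.of_norm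

theorem approx3Vec_ne_zero {d : ℕ} {β : ℝ} (hβ : 0 < β) (j : Fin d) : approx3Vec d β j ≠ 0 := by
  intro h
  have h1 := inner_fock_approx3Vec hβ j 0
  rw [h, inner_zero_right, approx3Coeff] at h1
  refine mul_ne_zero ?_ (idealState_vacuum_ne_zero j) h1.symm
  rw [Complex.ofReal_ne_zero]
  positivity

/-- Two evaluations of the comb on `fourierU (fockS n)`: the eigenvalue equation and Poisson
summation. -/
theorem neg_I_pow_mul_idealState {d : ℕ} (j : Fin d) (n : ℕ) :
    (-Complex.I) ^ n * idealState d j (fockS n) = ∑ k, dftCoeff d j k * idealState d k (fockS n) := by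
  rw [← idealState_fourierU, fourierU_fockS, map_smul, smul_eq_mul]

theorem adjoint_fourierOp_approx3Vec {d : ℕ} {β : ℝ} (hβ : 0 < β) (j : Fin d) :
    ContinuousLinearMap.adjoint fourierOp (approx3Vec d β j) =
      ∑ k, dftCoeff d j k • approx3Vec d β k := by
  refine ext_inner_fock fun n => ?_
  rw [inner_fock_adjoint_fourierOp, inner_sum]
  simp only [inner_smul_right, inner_fock_approx3Vec hβ, approx3Coeff]
  rw [mul_left_comm, neg_I_pow_mul_idealState, Finset.mul_sum]
  exact Finset.sum_congr rfl fun k _ => mul_left_comm _ _ _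

theorem N3_pos {d : ℕ} {β : ℝ} (hβ : 0 < β) (j : Fin d) : 0 < N3 d β j :=
  pow_pos (norm_pos_iff.2 (approx3Vec_ne_zero hβ j)) 2

theorem adjoint_fourierOp_ket3 {d : ℕ} {β : ℝ} (hβ : 0 < β) (j : Fin d) :
    ContinuousLinearMap.adjoint fourierOp (ket3 d β j) =
      ∑ k : Fin d, (dftCoeff d j k * ((√(N3 d β k / N3 d β j) : ℝ) : ℂ)) • ket3 d β k := by
  rw [ket3, map_smul]
  exact (adjoint_fourierOp_normalized_iff (approx3Vec_ne_zero hβ) j (approx3Vec_ne_zero hβ j)).2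
    (adjoint_fourierOp_approx3Vec hβ j)

/-- `F̂†` is injective and maps this finite-dimensional space into itself, hence onto; applying
`F̂`, a left inverse of `F̂†`, concludes. -/
theorem map_fourierOp_codeSpace3 {d : ℕ} {β : ℝ} (hβ : 0 < β) :
    Submodule.map (fourierOp : L2 →ₗ[ℂ] L2) (codeSpace3 d β) = codeSpace3 d β := by
  let A : L2 →ₗ[ℂ] L2 := (ContinuousLinearMap.adjoint fourierOp).toLinearMap
  have hinj : Function.Injective A :=
    Function.LeftInverse.injective (g := fourierOp) fourierOp_adjoint_fourierOp
  have hfin : FiniteDimensional ℂ (codeSpace3 d β) :=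
    FiniteDimensional.span_of_finite ℂ (Set.finite_range _)
  have hle : Submodule.map A (codeSpace3 d β) ≤ codeSpace3 d β := by
    rw [codeSpace3, Submodule.map_span, Submodule.span_le]
    rintro _ ⟨_, ⟨j, rfl⟩, rfl⟩
    have := adjoint_fourierOp_ket3 hβ j
    change ContinuousLinearMap.adjoint fourierOp (ket3 d β j) ∈ _
    rw [this]
    exact Submodule.sum_mem _ fun k _ => Submodule.smul_mem _ _ (Submodule.subset_span ⟨k, rfl⟩)
  have heq : Submodule.map A (codeSpace3 d β) = codeSpace3 d β :=
    Submodule.eq_of_le_of_finrank_eq hle (Submodule.equivMapOfInjective A hinj _).finrank_eq.symm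
  conv_lhs => rw [← heq]
  rw [← Submodule.map_comp]
  have : (fourierOp : L2 →ₗ[ℂ] L2) ∘ₗ A = LinearMap.id :=
    LinearMap.ext fourierOp_adjoint_fourierOp
  rw [this, Submodule.map_id]

/-! ### Displacements, their Gaussian mixture and its kernel -/

/-- The transpose of the displacement `V̂(r)`, on Schwartz functions. -/
def weyl (r : ℝ × ℝ) : 𝓢(ℝ, ℂ) →L[ℂ] 𝓢(ℝ, ℂ) :=
  Complex.exp (-Complex.I * r.1 * r.2 / 2) • (compSubConstCLM ℂ (-r.2) ∘L
    smulLeftCLM ℂ (fun q : ℝ => Complex.exp (Complex.I * r.1 * q)))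

theorem dispV_apply (r : ℝ × ℝ) (T : 𝓢'(ℝ, ℂ)) (u : 𝓢(ℝ, ℂ)) :
    dispV r T u = T (weyl r u) := by
  rw [weyl, smul_apply, map_smul]
  rfl

theorem hasTemperateGrowth_exp (a : ℝ) :
    (fun q : ℝ => Complex.exp (Complex.I * a * q)).HasTemperateGrowth := by
  have hd : ∀ n : ℕ, iteratedDeriv n (fun q : ℝ => Complex.exp (Complex.I * a * q)) =
      fun q : ℝ => (Complex.I * a) ^ n * Complex.exp (Complex.I * a * q) := fun n => by
    induction n with
    | zero => simp
    | succ n ih =>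
      ext q
      rw [iteratedDeriv_succ, ih]
      have h : HasDerivAt (fun q : ℝ => Complex.I * a * (q : ℂ)) (Complex.I * a * 1) q :=
        (Complex.ofRealCLM.hasDerivAt (x := q)).const_mul _
      refine (h.cexp.const_mul _).deriv.trans ?_
      ring
  refine ⟨(contDiff_const.mul Complex.ofRealCLM.contDiff).cexp, fun n => ⟨0, |a| ^ n, fun q => ?_⟩⟩
  rw [norm_iteratedFDeriv_eq_norm_iteratedDeriv, hd, norm_mul, norm_pow, norm_mul, Complex.norm_I,
    one_mul, Complex.norm_real, Real.norm_eq_abs, show Complex.I * a * q =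
      ((a * q : ℝ) : ℂ) * Complex.I by push_cast; ring, Complex.norm_exp_ofReal_mul_I, pow_zero]

theorem weyl_apply (r : ℝ × ℝ) (u : 𝓢(ℝ, ℂ)) (x : ℝ) :
    weyl r u x = Complex.exp (Complex.I * r.1 * (x + r.2 / 2)) * u (x + r.2) := by
  rw [weyl, smul_apply, smul_apply, ContinuousLinearMap.comp_apply, compSubConstCLM_apply,
    smulLeftCLM_apply_apply (hasTemperateGrowth_exp _), smul_eq_mul, smul_eq_mul, ← mul_assoc,
    ← Complex.exp_add, sub_neg_eq_add]
  congr 2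
  push_cast; ring

theorem norm_weyl_apply (r : ℝ × ℝ) (u : 𝓢(ℝ, ℂ)) (x : ℝ) : ‖weyl r u x‖ = ‖u (x + r.2)‖ := by
  rw [weyl_apply, norm_mul, show Complex.I * r.1 * (x + r.2 / 2) =
    ((r.1 * (x + r.2 / 2) : ℝ) : ℂ) * Complex.I by push_cast; ring,
    Complex.norm_exp_ofReal_mul_I, one_mul]

/-- The Fourier transform rotates displacements. -/
theorem weyl_fourierU (r : ℝ × ℝ) (u : 𝓢(ℝ, ℂ)) :
    weyl r (fourierU u) = fourierU (weyl (-r.2, r.1) u) := by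
  ext y
  rw [weyl_apply, fourierU_apply, fourierU_apply, mul_left_comm, ← integral_const_mul]
  -- Translating the integration variable by `r.1` makes the integrands agree pointwise; the
  -- symmetric phase in `weyl` leaves no residual factor.
  rw [← integral_add_right_eq_self (fun x : ℝ => Complex.exp (Complex.I * r.1 * (y + r.2 / 2)) *
    (Complex.exp (-Complex.I * x * ((y + r.2 : ℝ) : ℂ)) * u x)) r.1]
  congr 1
  refine integral_congr_ae (Filter.Eventually.of_forall fun x => ?_)
  simp only [weyl_apply]
  rw [← mul_assoc, ← mul_assoc, ← Complex.exp_add, ← Complex.exp_add]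
  congr 2
  push_cast; ring

theorem one_add_sq_mul_norm_weyl_le {u : 𝓢(ℝ, ℂ)} {C : ℝ} (hC : ∀ x, (1 + x ^ 2) * ‖u x‖ ≤ C)
    (r : ℝ × ℝ) (x : ℝ) : (1 + x ^ 2) * ‖weyl r u x‖ ≤ 2 * (1 + r.2 ^ 2) * C := by
  rw [norm_weyl_apply]
  have h := hC (x + r.2)
  -- Peetre's inequality: a displacement costs only a quadratic factor in `r.2`, which the Gaussian
  -- error wave absorbs.
  have h1 : 1 + x ^ 2 ≤ 2 * (1 + r.2 ^ 2) * (1 + (x + r.2) ^ 2) := by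
    nlinarith [sq_nonneg (x + 2 * r.2), mul_nonneg (sq_nonneg r.2) (sq_nonneg (x + r.2))]
  calc _ ≤ 2 * (1 + r.2 ^ 2) * (1 + (x + r.2) ^ 2) * ‖u (x + r.2)‖ := by gcongr
    _ = 2 * (1 + r.2 ^ 2) * ((1 + (x + r.2) ^ 2) * ‖u (x + r.2)‖) := by ring
    _ ≤ _ := by gcongr

theorem continuous_weyl (u : 𝓢(ℝ, ℂ)) (y : ℝ) : Continuous fun r => weyl r u y := by
  have := u.continuous
  simp only [weyl_apply]
  fun_prop

theorem continuous_errorWave (γ δ : ℝ) : Continuous (errorWave γ δ) := by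
  unfold errorWave
  fun_prop

theorem errorWave_pos {γ δ : ℝ} (hγ : 0 < γ) (hδ : 0 < δ) (r : ℝ × ℝ) : 0 < errorWave γ δ r := by
  unfold errorWave
  positivity

theorem errorWave_eq_mul (γ δ : ℝ) (r : ℝ × ℝ) :
    errorWave γ δ r = (2 * Real.pi * γ * δ)⁻¹ * (Real.exp (-(1 / (2 * γ ^ 2)) * r.1 ^ 2) *
      Real.exp (-(1 / (2 * δ ^ 2)) * r.2 ^ 2)) := by
  rw [errorWave, ← Real.exp_add, div_eq_inv_mul]
  congr 2
  ring

theorem integrable_errorWave_mul {γ δ : ℝ} (hγ : 0 < γ) (hδ : 0 < δ) :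
    Integrable fun r : ℝ × ℝ => errorWave γ δ r * (1 + r.2 ^ 2) := by
  have h1 := integrable_exp_neg_mul_sq (b := 1 / (2 * γ ^ 2)) (by positivity)
  have h2 := integrable_exp_neg_mul_sq (b := 1 / (2 * δ ^ 2)) (by positivity)
  have h3 := integrable_rpow_mul_exp_neg_mul_sq (b := 1 / (2 * δ ^ 2)) (by positivity) (s := 2)
    (by norm_num)
  have h := (h1.mul_prod (h2.add h3)).const_mul (2 * Real.pi * γ * δ)⁻¹
  refine h.congr (Filter.Eventually.of_forall fun r => ?_)
  simp only [Pi.add_apply, Real.rpow_two]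
  rw [errorWave_eq_mul]
  ring

theorem norm_errorWave_mul_le {γ δ : ℝ} (hγ : 0 < γ) (hδ : 0 < δ) {u : 𝓢(ℝ, ℂ)} {C : ℝ}
    (hC : ∀ x, (1 + x ^ 2) * ‖u x‖ ≤ C) (r : ℝ × ℝ) (y : ℝ) :
    ‖(errorWave γ δ r : ℂ) * weyl r u y‖ ≤
      errorWave γ δ r * (1 + r.2 ^ 2) * (2 * C) * (1 + y ^ 2)⁻¹ := by
  rw [norm_mul, Complex.norm_real, Real.norm_of_nonneg (errorWave_pos hγ hδ r).le]
  have := norm_le_inv_one_add_sq (one_add_sq_mul_norm_weyl_le hC r) y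
  have h0 := (errorWave_pos hγ hδ r).le
  calc _ ≤ errorWave γ δ r * (2 * (1 + r.2 ^ 2) * C * (1 + y ^ 2)⁻¹) := by gcongr
    _ = _ := by ring

theorem integrable_errorWave_mul_weyl {γ δ : ℝ} (hγ : 0 < γ) (hδ : 0 < δ) (u : 𝓢(ℝ, ℂ)) (y : ℝ) :
    Integrable fun r : ℝ × ℝ => (errorWave γ δ r : ℂ) * weyl r u y := by
  refine (((integrable_errorWave_mul hγ hδ).mul_const _).mul_const _).mono' ?_
    (Filter.Eventually.of_forall fun r =>
      norm_errorWave_mul_le hγ hδ (one_add_sq_mul_norm_le u) r y)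
  have := continuous_errorWave γ δ
  have := continuous_weyl u y
  exact Continuous.aestronglyMeasurable (by fun_prop)

/-- Exchanges the comb sum with the Gaussian integral over displacements, by domination with a
product of an integrable function of `r` and a summable function of `s`. -/
theorem hasSum_integral_errorWave_mul_weyl {γ δ : ℝ} (hγ : 0 < γ) (hδ : 0 < δ) (u : 𝓢(ℝ, ℂ))
    {y : ℤ → ℝ} (hy : Summable fun s => (1 + y s ^ 2)⁻¹) :
    Integrable (fun r : ℝ × ℝ => (errorWave γ δ r : ℂ) * ∑' s, weyl r u (y s)) ∧
    HasSum (fun s => ∫ r : ℝ × ℝ, (errorWave γ δ r : ℂ) * weyl r u (y s))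
      (∫ r : ℝ × ℝ, (errorWave γ δ r : ℂ) * ∑' s, weyl r u (y s)) := by
  have hC := one_add_sq_mul_norm_le u
  set C := SchwartzMap.seminorm ℂ 0 0 u + SchwartzMap.seminorm ℂ 2 0 u
  have hB := (integrable_errorWave_mul hγ hδ).mul_const (2 * C)
  have hlim : ∀ r : ℝ × ℝ, HasSum (fun s => (errorWave γ δ r : ℂ) * weyl r u (y s))
      ((errorWave γ δ r : ℂ) * ∑' s, weyl r u (y s)) := fun r =>
    (summable_norm_comp hy (weyl r u)).of_norm.hasSum.mul_left _
  have hbd := norm_errorWave_mul_le hγ hδ hC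
  have hm := fun s => (integrable_errorWave_mul_weyl hγ hδ u (y s)).1
  constructor
  · refine (hB.mul_const (∑' s, (1 + y s ^ 2)⁻¹)).mono' ?_ (Filter.Eventually.of_forall fun r => ?_)
    · refine aestronglyMeasurable_of_tendsto_ae (Filter.atTop : Filter (Finset ℤ))
        (f := fun t r => ∑ s ∈ t, (errorWave γ δ r : ℂ) * weyl r u (y s)) (fun t => ?_)
        (Filter.Eventually.of_forall hlim)
      exact Finset.aestronglyMeasurable_fun_sum t fun s _ => hm s
    · rw [← (hlim r).tsum_eq, ← tsum_mul_left]
      exact tsum_of_norm_bounded (hy.mul_left _).hasSum fun s => hbd r (y s)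
  · refine hasSum_integral_of_dominated_convergence
      (fun s r => errorWave γ δ r * (1 + r.2 ^ 2) * (2 * C) * (1 + y s ^ 2)⁻¹) hm
      (fun s => Filter.Eventually.of_forall fun r => hbd r (y s))
      (Filter.Eventually.of_forall fun r => hy.mul_left _) ?_ (Filter.Eventually.of_forall hlim)
    simp only [tsum_mul_left]
    exact hB.mul_const _

/-- The integral kernel of the Gaussian mixture of displacements `∬ errorWave(r) V̂(r) dr`. -/
def gaussKernel (γ δ x y : ℝ) : ℝ :=
  (√(2 * Real.pi) * δ)⁻¹ *
    Real.exp (-((x - y) ^ 2 / (2 * δ ^ 2)) - γ ^ 2 * (x + y) ^ 2 / 8)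

theorem gaussKernel_pos {γ δ : ℝ} (hδ : 0 < δ) (x y : ℝ) : 0 < gaussKernel γ δ x y := by
  unfold gaussKernel; positivity

theorem continuous_gaussKernel (γ δ y : ℝ) : Continuous fun x => gaussKernel γ δ x y := by
  unfold gaussKernel; fun_prop

/-- The `r₁` integral is the Fourier transform of a Gaussian at `y + r₂/2`. With `x = y + r₂` this
is the midpoint `(x + y)/2`, which yields the factor `exp (-γ² (x + y)² / 8)`. -/
theorem integral_errorWave_mul_weyl {γ δ : ℝ} (hγ : 0 < γ) (hδ : 0 < δ) (u : 𝓢(ℝ, ℂ)) (y : ℝ) :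
    ∫ r : ℝ × ℝ, (errorWave γ δ r : ℂ) * weyl r u y = ∫ x, (gaussKernel γ δ x y : ℂ) * u x := by
  rw [Measure.volume_eq_prod, integral_prod_symm _ (integrable_errorWave_mul_weyl hγ hδ u y),
    ← integral_add_left_eq_self (fun x => (gaussKernel γ δ x y : ℂ) * u x) y]
  refine integral_congr_ae (Filter.Eventually.of_forall fun r₂ => ?_)
  have hg := fourierIntegral_gaussian (b := 1 / (2 * γ ^ 2)) (by
    rw [show (1 / (2 * γ ^ 2) : ℂ) = ((1 / (2 * γ ^ 2) : ℝ) : ℂ) by push_cast; rfl,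
      Complex.ofReal_re]
    positivity) (y + r₂ / 2)
  have e : ∀ r₁ : ℝ, (errorWave γ δ (r₁, r₂) : ℂ) * weyl (r₁, r₂) u y =
      (2 * Real.pi * γ * δ)⁻¹ * Real.exp (-(1 / (2 * δ ^ 2)) * r₂ ^ 2) * u (y + r₂) *
        (Complex.exp (Complex.I * (y + r₂ / 2) * r₁) * Complex.exp (-(1 / (2 * γ ^ 2)) * r₁ ^ 2)) :=
    fun r₁ => by
    rw [errorWave_eq_mul, weyl_apply]
    push_cast
    rw [mul_right_comm Complex.I]
    ring
  simp only [e]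
  rw [integral_const_mul, hg]
  have h2 : ((Real.pi : ℂ) / (1 / (2 * γ ^ 2))) ^ (1 / 2 : ℂ) = ((√(2 * Real.pi) * γ : ℝ) : ℂ) := by
    have hs : √(2 * Real.pi) * γ = (2 * Real.pi * γ ^ 2) ^ (1 / 2 : ℝ) := by
      rw [← Real.sqrt_eq_rpow, Real.sqrt_mul (by positivity : (0 : ℝ) ≤ 2 * Real.pi) (γ ^ 2),
        Real.sqrt_sq hγ.le]
    rw [hs, Complex.ofReal_cpow (by positivity)]
    push_cast; congr 1; field_simp
  have h3 : ((√(2 * Real.pi) : ℝ) : ℂ) ≠ 0 := by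
    rw [Complex.ofReal_ne_zero]; positivity
  have h4 : ((√(2 * Real.pi) : ℝ) : ℂ) * ((√(2 * Real.pi) : ℝ) : ℂ) = 2 * Real.pi := by
    rw [← Complex.ofReal_mul, Real.mul_self_sqrt (by positivity)]; push_cast; rfl
  have hγ' : (γ : ℂ) ≠ 0 := by exact_mod_cast hγ.ne'
  have hδ' : (δ : ℂ) ≠ 0 := by exact_mod_cast hδ.ne'
  have h5 : ((gaussKernel γ δ (y + r₂) y : ℝ) : ℂ) = (((√(2 * Real.pi) : ℝ) : ℂ) * δ)⁻¹ *
      (Complex.exp (-(1 / (2 * δ ^ 2)) * r₂ ^ 2) *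
        Complex.exp (-(y + r₂ / 2) ^ 2 / (4 * (1 / (2 * γ ^ 2))))) := by
    rw [gaussKernel, ← Complex.exp_add]
    push_cast
    congr 2
    field_simp
    ring
  rw [h2, h5]
  push_cast
  rw [← h4]
  field_simp

theorem exists_gaussKernel_le {γ δ : ℝ} (hγ : 0 < γ) (hδ : 0 < δ) :
    ∃ C c : ℝ, 0 < C ∧ 0 < c ∧
      ∀ x y, gaussKernel γ δ x y ≤ C * Real.exp (-c * x ^ 2) * (1 + y ^ 2)⁻¹ := by
  -- Replacing both quadratic coefficients by the smaller one and using `(x - y)² + (x + y)² = 2x² +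
  -- 2y²` separates the variables; `1 + t ≤ exp t` then weakens the `y` factor to a multiple of `(1
  -- + y²)⁻¹`.
  set m := min (1 / (2 * δ ^ 2)) (γ ^ 2 / 8) with hm
  have hm0 : 0 < m := lt_min (by positivity) (by positivity)
  refine ⟨(√(2 * Real.pi) * δ)⁻¹ * (1 + 1 / (2 * m)), 2 * m, by positivity, by positivity,
    fun x y => ?_⟩
  have h1 : m * (x - y) ^ 2 ≤ 1 / (2 * δ ^ 2) * (x - y) ^ 2 := by
    gcongr; exact min_le_left _ _
  have h2 : m * (x + y) ^ 2 ≤ γ ^ 2 / 8 * (x + y) ^ 2 := by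
    gcongr; exact min_le_right _ _
  have h3 : Real.exp (-((x - y) ^ 2 / (2 * δ ^ 2)) - γ ^ 2 * (x + y) ^ 2 / 8) ≤
      Real.exp (-(2 * m) * x ^ 2) * Real.exp (-(2 * m * y ^ 2)) := by
    rw [← Real.exp_add, Real.exp_le_exp]
    have e1 : (x - y) ^ 2 / (2 * δ ^ 2) = 1 / (2 * δ ^ 2) * (x - y) ^ 2 := by ring
    rw [e1]
    nlinarith
  have h4 : Real.exp (-(2 * m * y ^ 2)) ≤ (1 + 1 / (2 * m)) * (1 + y ^ 2)⁻¹ := by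
    rw [Real.exp_neg, ← div_eq_mul_inv, inv_le_comm₀ (Real.exp_pos _) (by positivity), inv_div,
      div_le_iff₀ (by positivity)]
    have h5 := Real.add_one_le_exp (2 * m * y ^ 2)
    have h6 : 1 + y ^ 2 ≤ (2 * m * y ^ 2 + 1) * (1 + 1 / (2 * m)) := by
      have : (2 * m * y ^ 2 + 1) * (1 + 1 / (2 * m)) = 1 + y ^ 2 + (2 * m * y ^ 2 + 1 / (2 * m)) := by
        field_simp; ring
      rw [this]
      have : 0 ≤ 2 * m * y ^ 2 + 1 / (2 * m) := by positivity
      linarith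
    exact h6.trans (by gcongr)
  calc _ ≤ (√(2 * Real.pi) * δ)⁻¹ *
        (Real.exp (-(2 * m) * x ^ 2) * ((1 + 1 / (2 * m)) * (1 + y ^ 2)⁻¹)) := by
        unfold gaussKernel
        gcongr
        exact h3.trans (by gcongr)
    _ = _ := by ring

theorem summable_gaussKernel {γ δ : ℝ} (hγ : 0 < γ) (hδ : 0 < δ) {y : ℤ → ℝ}
    (hy : Summable fun s => (1 + y s ^ 2)⁻¹) (x : ℝ) : Summable fun s => gaussKernel γ δ x (y s) := by
  obtain ⟨C, c, hC, hc, h⟩ := exists_gaussKernel_le hγ hδ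
  exact (hy.mul_left _).of_nonneg_of_le (fun s => (gaussKernel_pos hδ _ _).le) fun s => h x (y s)

/-- The wave function obtained from the weighted Dirac comb `∑ₛ c_s |y_s⟩`. -/
def combWave (γ δ : ℝ) (c : ℤ → ℂ) (y : ℤ → ℝ) (x : ℝ) : ℂ :=
  ∑' s, c s * (gaussKernel γ δ x (y s) : ℂ)

theorem norm_mul_gaussKernel {γ δ : ℝ} (hδ : 0 < δ) {c : ℂ} (hc : ‖c‖ = 1) (x y : ℝ) :
    ‖c * (gaussKernel γ δ x y : ℂ)‖ = gaussKernel γ δ x y := by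
  rw [norm_mul, hc, one_mul, Complex.norm_real, Real.norm_of_nonneg (gaussKernel_pos hδ _ _).le]

theorem summable_combWave {γ δ : ℝ} (hγ : 0 < γ) (hδ : 0 < δ) {c : ℤ → ℂ} (hc : ∀ s, ‖c s‖ = 1)
    {y : ℤ → ℝ} (hy : Summable fun s => (1 + y s ^ 2)⁻¹) (x : ℝ) :
    Summable fun s => c s * (gaussKernel γ δ x (y s) : ℂ) := by
  refine Summable.of_norm ?_
  simp only [norm_mul_gaussKernel hδ (hc _)]
  exact summable_gaussKernel hγ hδ hy x

theorem continuous_combWave {γ δ : ℝ} (hγ : 0 < γ) (hδ : 0 < δ) {c : ℤ → ℂ} (hc : ∀ s, ‖c s‖ = 1)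
    {y : ℤ → ℝ} (hy : Summable fun s => (1 + y s ^ 2)⁻¹) : Continuous (combWave γ δ c y) := by
  obtain ⟨C, b, hC, hb, h⟩ := exists_gaussKernel_le hγ hδ
  refine continuous_tsum (u := fun s => C * (1 + y s ^ 2)⁻¹) (fun s => ?_) (hy.mul_left C)
    fun s x => ?_
  · have := continuous_gaussKernel γ δ (y s)
    fun_prop
  · rw [norm_mul_gaussKernel hδ (hc s)]
    refine (h x (y s)).trans ?_
    have : Real.exp (-b * x ^ 2) ≤ 1 := Real.exp_le_one_iff.2 (by nlinarith [sq_nonneg x])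
    have h1 : C * Real.exp (-b * x ^ 2) ≤ C := by nlinarith
    gcongr

theorem memLp_combWave {γ δ : ℝ} (hγ : 0 < γ) (hδ : 0 < δ) {c : ℤ → ℂ} (hc : ∀ s, ‖c s‖ = 1)
    {y : ℤ → ℝ} (hy : Summable fun s => (1 + y s ^ 2)⁻¹) :
    MemLp (combWave γ δ c y) 2 volume := by
  obtain ⟨C, b, hC, hb, h⟩ := exists_gaussKernel_le hγ hδ
  have hm := (continuous_combWave hγ hδ hc hy).aestronglyMeasurable (μ := volume)
  rw [memLp_two_iff_integrable_sq_norm hm]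
  set D := C * ∑' s, (1 + y s ^ 2)⁻¹ with hD
  have hle : ∀ x, ‖combWave γ δ c y x‖ ≤ D * Real.exp (-b * x ^ 2) := fun x => by
    have := tsum_of_norm_bounded (hy.mul_left (C * Real.exp (-b * x ^ 2))).hasSum
      fun s => (norm_mul_gaussKernel (γ := γ) hδ (hc s) x (y s)).trans_le (h x (y s))
    refine this.trans (le_of_eq ?_)
    rw [tsum_mul_left, hD]; ring
  refine ((integrable_exp_neg_mul_sq (b := 2 * b) (by positivity)).const_mul (D ^ 2)).mono'
    (hm.norm.pow 2) (Filter.Eventually.of_forall fun x => ?_)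
  rw [Real.norm_of_nonneg (by positivity)]
  refine (pow_le_pow_left₀ (norm_nonneg _) (hle x) 2).trans (le_of_eq ?_)
  rw [mul_pow, ← Real.exp_nat_mul]
  congr 2
  push_cast; ring

theorem hasSum_integral_gaussKernel_mul {γ δ : ℝ} (hγ : 0 < γ) (hδ : 0 < δ) {y : ℤ → ℝ}
    (hy : Summable fun s => (1 + y s ^ 2)⁻¹) (u : 𝓢(ℝ, ℂ)) :
    HasSum (fun s => ∫ x, (gaussKernel γ δ x (y s) : ℂ) * u x)
      (∫ x, combWave γ δ 1 y x * u x) := by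
  obtain ⟨C, b, hC, hb, h⟩ := exists_gaussKernel_le hγ hδ
  have hs := hy.mul_left C
  refine hasSum_integral_of_dominated_convergence
    (fun s x => C * (1 + y s ^ 2)⁻¹ * ‖u x‖) (fun s => ?_)
    (fun s => Filter.Eventually.of_forall fun x => ?_)
    (Filter.Eventually.of_forall fun x => hs.mul_right _) ?_
    (Filter.Eventually.of_forall fun x => ?_)
  · have := continuous_gaussKernel γ δ (y s)
    have := u.continuous
    exact Continuous.aestronglyMeasurable (by fun_prop)
  · rw [norm_mul, Complex.norm_real, Real.norm_of_nonneg (gaussKernel_pos hδ _ _).le]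
    refine mul_le_mul_of_nonneg_right ((h x (y s)).trans ?_) (norm_nonneg _)
    have : Real.exp (-b * x ^ 2) ≤ 1 := Real.exp_le_one_iff.2 (by nlinarith [sq_nonneg x])
    have h1 : C * Real.exp (-b * x ^ 2) ≤ C := by nlinarith
    gcongr
  · simp only [tsum_mul_right]
    exact u.integrable.norm.const_mul _
  · have := (summable_combWave hγ hδ (c := 1) (fun _ => by simp) hy x).hasSum.mul_right (u x)
    simpa only [Pi.one_apply, one_mul, combWave] using this

/-! ### Approximation 2: existence, uniqueness and nonvanishing -/

/-- The wave function of the unnormalized state of Approximation 2. -/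
def wave2 (d : ℕ) (γ δ : ℝ) (j : Fin d) (x : ℝ) : ℂ :=
  ((√(alpha d * d) : ℝ) : ℂ) * combWave γ δ 1 (node d j) x

theorem memLp_wave2 {d : ℕ} {γ δ : ℝ} (hγ : 0 < γ) (hδ : 0 < δ) (j : Fin d) :
    MemLp (wave2 d γ δ j) 2 volume :=
  (memLp_combWave hγ hδ (fun _ => by simp) (summable_node j)).const_mul _

/-- Shows that the weak integral is an `L²` vector, so `approx2Vec` is not the default value `0`. -/
theorem isApprox2Vec_wave2 {d : ℕ} {γ δ : ℝ} (hγ : 0 < γ) (hδ : 0 < δ) (j : Fin d) :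
    IsApprox2Vec d γ δ j (memLp_wave2 hγ hδ j).toLp := by
  intro u
  have h := hasSum_integral_errorWave_mul_weyl hγ hδ u (summable_node j)
  have e : ∀ r : ℝ × ℝ, (errorWave γ δ r : ℂ) * dispV r (idealState d j) u =
      ((√(alpha d * d) : ℝ) : ℂ) * ((errorWave γ δ r : ℂ) * ∑' s, weyl r u (node d j s)) :=
    fun r => by rw [dispV_apply, idealState_apply]; ring
  simp only [e]
  refine ⟨h.1.const_mul _, ?_⟩
  have h2 := h.2
  simp only [integral_errorWave_mul_weyl hγ hδ] at h2
  rw [integral_const_mul, ← (hasSum_integral_gaussKernel_mul hγ hδ (summable_node j) u).unique h2,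
    Lp.toTemperedDistribution_apply, ← integral_const_mul]
  refine integral_congr_ae ?_
  filter_upwards [(memLp_wave2 hγ hδ j).coeFn_toLp] with x hx
  rw [hx, wave2, smul_eq_mul]
  ring

theorem IsApprox2Vec.unique {d : ℕ} {γ δ : ℝ} {j : Fin d} {f g : L2}
    (hf : IsApprox2Vec d γ δ j f) (hg : IsApprox2Vec d γ δ j g) : f = g :=
  ext_inner_fock fun n => by
    rw [← coe_fockS_eq_inner, ← coe_fockS_eq_inner, (hf _).2, (hg _).2]

theorem isApprox2Vec_approx2Vec {d : ℕ} {γ δ : ℝ} (hγ : 0 < γ) (hδ : 0 < δ) (j : Fin d) :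
    IsApprox2Vec d γ δ j (approx2Vec d γ δ j) := by
  have h : ∃ f, IsApprox2Vec d γ δ j f := ⟨_, isApprox2Vec_wave2 hγ hδ j⟩
  rw [approx2Vec, dif_pos h]
  exact h.choose_spec

theorem approx2Vec_ae_eq {d : ℕ} {γ δ : ℝ} (hγ : 0 < γ) (hδ : 0 < δ) (j : Fin d) :
    approx2Vec d γ δ j =ᵐ[volume] wave2 d γ δ j := by
  rw [(isApprox2Vec_approx2Vec hγ hδ j).unique (isApprox2Vec_wave2 hγ hδ j)]
  exact (memLp_wave2 hγ hδ j).coeFn_toLp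

theorem wave2_ne_zero {d : ℕ} {γ δ : ℝ} (hγ : 0 < γ) (hδ : 0 < δ) (j : Fin d) (x : ℝ) :
    wave2 d γ δ j x ≠ 0 := by
  refine mul_ne_zero (sqrt_alpha_mul_ne_zero j.pos) ?_
  simp only [combWave, Pi.one_apply, one_mul]
  exact tsum_ofReal_ne_zero (fun s => gaussKernel_pos hδ _ _)
    (summable_gaussKernel hγ hδ (summable_node j) x)

theorem approx2Vec_ne_zero {d : ℕ} {γ δ : ℝ} (hγ : 0 < γ) (hδ : 0 < δ) (j : Fin d) :
    approx2Vec d γ δ j ≠ 0 := by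
  intro h
  have h1 := approx2Vec_ae_eq hγ hδ j
  rw [h] at h1
  obtain ⟨x, h2, h3⟩ := ((Lp.coeFn_zero ℂ 2 volume).and h1).exists
  exact wave2_ne_zero hγ hδ j x (h3.symm.trans h2)

/-! ### The Fourier operator exchanges the two widths -/

theorem errorWave_rotate (γ δ : ℝ) (r : ℝ × ℝ) : errorWave δ γ (-r.2, r.1) = errorWave γ δ r := by
  unfold errorWave
  rw [mul_right_comm _ δ γ]
  congr 2
  simp only
  ring

theorem integral_rotate {E : Type*} [NormedAddCommGroup E] [NormedSpace ℝ E] (f : ℝ × ℝ → E) :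
    ∫ r : ℝ × ℝ, f (-r.2, r.1) = ∫ r, f r := by
  have h : MeasurePreserving (fun r : ℝ × ℝ => (-r.2, r.1)) :=
    ((Measure.measurePreserving_neg (volume : Measure ℝ)).prod (MeasurePreserving.id volume)).comp
      Measure.measurePreserving_swap
  have he : MeasurableEmbedding (fun r : ℝ × ℝ => (-r.2, r.1)) :=
    ((MeasurableEquiv.prodComm).trans
      ((MeasurableEquiv.neg ℝ).prodCongr (MeasurableEquiv.refl ℝ))).measurableEmbedding
  exact h.integral_comp he f

/-- The inverse Fourier operator exchanges `γ` and `δ`. -/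
theorem adjoint_fourierOp_approx2Vec {d : ℕ} {γ δ : ℝ} (hγ : 0 < γ) (hδ : 0 < δ) (j : Fin d) :
    ContinuousLinearMap.adjoint fourierOp (approx2Vec d γ δ j) =
      ∑ k, dftCoeff d j k • approx2Vec d δ γ k := by
  refine ext_inner_fock fun n => ?_
  rw [inner_fock_adjoint_fourierOp, inner_sum]
  simp only [inner_smul_right, ← coe_fockS_eq_inner]
  have h := fun k : Fin d => isApprox2Vec_approx2Vec hδ hγ k (fockS n)
  -- The factor `(-i)^n` is absorbed by replacing the test function with its `fourierU`, which is
  -- then carried through the displacement and the comb.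
  rw [← smul_eq_mul, ← map_smul, ← fourierU_fockS, (isApprox2Vec_approx2Vec hγ hδ j _).2]
  simp only [(h _).2, ← integral_const_mul]
  rw [← integral_finsetSum _ fun k _ => (h k).1.const_mul _,
    ← integral_rotate (fun r => ∑ k, dftCoeff d j k *
      ((errorWave δ γ r : ℂ) * dispV r (idealState d k) (fockS n)))]
  refine integral_congr_ae (Filter.Eventually.of_forall fun r => ?_)
  simp only [errorWave_rotate]
  rw [dispV_apply, weyl_fourierU, idealState_fourierU, Finset.mul_sum]
  refine Finset.sum_congr rfl fun k _ => ?_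
  rw [dispV_apply, mul_left_comm]

/-! ### Rigidity: the relation forces equal widths -/

/-- Translation by one lattice site multiplies the kernel by an exponential. -/
theorem gaussKernel_add {γ δ a : ℝ} (hδ : 0 < δ) (h : 4 - γ ^ 2 * δ ^ 2 ≠ 0) (x y : ℝ) :
    gaussKernel γ δ (x + a * (4 + γ ^ 2 * δ ^ 2) / (4 - γ ^ 2 * δ ^ 2)) (y + a) =
      Real.exp (-(4 * a * (γ ^ 2 * δ ^ 2) / (δ ^ 2 * (4 - γ ^ 2 * δ ^ 2))) * x +
        (4 + γ ^ 2 * δ ^ 2) / (8 * δ ^ 2) *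
          (a ^ 2 - (a * (4 + γ ^ 2 * δ ^ 2) / (4 - γ ^ 2 * δ ^ 2)) ^ 2)) * gaussKernel γ δ x y := by
  -- The shift in `x` is chosen so that the terms linear in `y` in the exponent cancel: the square
  -- term contributes `-(4 + γ²δ²) a / (4δ²)` and the cross term `(4 - γ²δ²) t / (4δ²)`.
  rw [gaussKernel, gaussKernel, mul_left_comm, ← Real.exp_add]
  congr 2
  field_simp
  ring

/-- The factor in `gaussKernel_add` does not involve `y`, so after `m ↦ m + 1` it leaves the sum,
together with one phase. -/
theorem combWave_add {d : ℕ} (j : ℕ) {γ δ a : ℝ} (hδ : 0 < δ) (h : 4 - γ ^ 2 * δ ^ 2 ≠ 0)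
    (x : ℝ) :
    combWave γ δ (dftPhase d j) (fun m => a * m)
        (x + a * (4 + γ ^ 2 * δ ^ 2) / (4 - γ ^ 2 * δ ^ 2)) =
      dftPhase d j 1 *
        (Real.exp (-(4 * a * (γ ^ 2 * δ ^ 2) / (δ ^ 2 * (4 - γ ^ 2 * δ ^ 2))) * x +
          (4 + γ ^ 2 * δ ^ 2) / (8 * δ ^ 2) *
            (a ^ 2 - (a * (4 + γ ^ 2 * δ ^ 2) / (4 - γ ^ 2 * δ ^ 2)) ^ 2)) : ℝ) *
        combWave γ δ (dftPhase d j) (fun m => a * m) x := by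
  rw [combWave, combWave, ← (Equiv.addRight (1 : ℤ)).tsum_eq, ← tsum_mul_left]
  refine tsum_congr fun m => ?_
  rw [Equiv.coe_addRight, dftPhase_add, Int.cast_add, Int.cast_one,
    show a * ((m : ℝ) + 1) = a * m + a by ring, gaussKernel_add hδ h]
  push_cast
  ring

theorem eq_of_combWave_eq {d : ℕ} (j : ℕ) {γ δ a : ℝ} (hγ : 0 < γ) (hδ : 0 < δ) (hγδ : γ * δ < 2)
    (ha : 0 < a)
    (heq : combWave γ δ (dftPhase d j) (fun m => a * m) =
      combWave δ γ (dftPhase d j) (fun m => a * m))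
    (hne : ∃ x, combWave γ δ (dftPhase d j) (fun m => a * m) x ≠ 0) : γ = δ := by
  obtain ⟨x, hx⟩ := hne
  have hp : 0 < 4 - γ ^ 2 * δ ^ 2 := by
    have : 0 < γ * δ := mul_pos hγ hδ
    nlinarith
  have hp' : 4 - δ ^ 2 * γ ^ 2 ≠ 0 := by rw [mul_comm]; exact hp.ne'
  have key : ∀ x, combWave γ δ (dftPhase d j) (fun m => a * m) x ≠ 0 →
      -(4 * a * (γ ^ 2 * δ ^ 2) / (δ ^ 2 * (4 - γ ^ 2 * δ ^ 2))) * x +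
        (4 + γ ^ 2 * δ ^ 2) / (8 * δ ^ 2) *
          (a ^ 2 - (a * (4 + γ ^ 2 * δ ^ 2) / (4 - γ ^ 2 * δ ^ 2)) ^ 2) =
      -(4 * a * (γ ^ 2 * δ ^ 2) / (γ ^ 2 * (4 - γ ^ 2 * δ ^ 2))) * x +
        (4 + γ ^ 2 * δ ^ 2) / (8 * γ ^ 2) *
          (a ^ 2 - (a * (4 + γ ^ 2 * δ ^ 2) / (4 - γ ^ 2 * δ ^ 2)) ^ 2) := fun x hx => by
    have h1 := combWave_add (d := d) (a := a) j hδ hp.ne' x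
    -- The shift is symmetric in `γ` and `δ`, so both relations concern the same point; dividing by
    -- the common nonzero wave equates the exponents.
    have h2 := combWave_add (d := d) (a := a) j hγ hp' x
    rw [mul_comm (δ ^ 2) (γ ^ 2), ← heq, h1] at h2
    have h3 := mul_left_cancel₀ (dftPhase_ne_zero d j 1) (mul_right_cancel₀ hx h2)
    exact Real.exp_injective (Complex.ofReal_injective h3)
  have k1 := key x hx
  -- The exponential factor never vanishes, so the shifted point is again a nonzero. Two points
  -- eliminate the constant terms and isolate the slopes.
  have hx' : combWave γ δ (dftPhase d j) (fun m => a * m)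
      (x + a * (4 + γ ^ 2 * δ ^ 2) / (4 - γ ^ 2 * δ ^ 2)) ≠ 0 := by
    rw [combWave_add j hδ hp.ne']
    refine mul_ne_zero (mul_ne_zero (dftPhase_ne_zero d j 1) ?_) hx
    rw [Complex.ofReal_ne_zero]
    exact (Real.exp_pos _).ne'
  have k2 := key _ hx'
  have ht : 0 < a * (4 + γ ^ 2 * δ ^ 2) / (4 - γ ^ 2 * δ ^ 2) := by positivity
  have k3 : 4 * a * (γ ^ 2 * δ ^ 2) / (δ ^ 2 * (4 - γ ^ 2 * δ ^ 2)) =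
      4 * a * (γ ^ 2 * δ ^ 2) / (γ ^ 2 * (4 - γ ^ 2 * δ ^ 2)) := by
    refine mul_right_cancel₀ ht.ne' ?_
    linarith
  have k4 : γ ^ 2 = δ ^ 2 := by
    rw [div_eq_div_iff (by positivity) (by positivity)] at k3
    have k5 := mul_left_cancel₀ (by positivity) k3
    exact mul_right_cancel₀ hp.ne' k5
  exact (sq_eq_sq₀ hγ.le hδ.le).1 k4

/-- The `d` combs are the residue classes of `α_d ℤ`, so their discrete Fourier transform is one
phased comb, whose step is a single lattice site. -/
theorem sum_dftCoeff_smul_wave2 {d : ℕ} {γ δ : ℝ} (hγ : 0 < γ) (hδ : 0 < δ) (j : Fin d) (x : ℝ) :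
    ∑ k, dftCoeff d j k * wave2 d γ δ k x = ((√(alpha d * d) : ℝ) : ℂ) / ((√d : ℝ) : ℂ) *
      combWave γ δ (dftPhase d j) (fun m => alpha d * m) x := by
  have hs : Summable fun m : ℤ => ‖((gaussKernel γ δ x (alpha d * m) : ℝ) : ℂ)‖ := by
    have := (summable_combWave hγ hδ (c := 1) (fun _ => by simp) (summable_lattice j.pos) x).norm
    simpa using this
  rw [combWave, ← sum_dftPhase_mul_tsum j.pos j
    (F := fun y => ((gaussKernel γ δ x y : ℝ) : ℂ)) hs, Finset.mul_sum]
  refine Finset.sum_congr rfl fun k _ => ?_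
  rw [dftCoeff_eq, wave2, combWave]
  simp only [Pi.one_apply, one_mul]
  ring

theorem sum_dftCoeff_smul_approx2Vec_ae_eq {d : ℕ} {γ δ : ℝ} (hγ : 0 < γ) (hδ : 0 < δ)
    (j : Fin d) :
    (∑ k, dftCoeff d j k • approx2Vec d γ δ k : L2) =ᵐ[volume] fun x =>
      ((√(alpha d * d) : ℝ) : ℂ) / ((√d : ℝ) : ℂ) *
        combWave γ δ (dftPhase d j) (fun m => alpha d * m) x := by
  have h1 := Lp.coeFn_finsetSum (μ := volume) Finset.univ fun k => dftCoeff d j k • approx2Vec d γ δ k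
  have h2 : ∀ᵐ x, ∀ k, (dftCoeff d j k • approx2Vec d γ δ k : L2) x =
      dftCoeff d j k * wave2 d γ δ k x := by
    rw [ae_all_iff]
    intro k
    filter_upwards [Lp.coeFn_smul (dftCoeff d j k) (approx2Vec d γ δ k),
      approx2Vec_ae_eq hγ hδ k] with x hx hx'
    rw [hx, Pi.smul_apply, hx', smul_eq_mul]
  filter_upwards [h1, h2] with x hx hx'
  rw [hx, ← sum_dftCoeff_smul_wave2 hγ hδ]
  simp only [Finset.sum_apply, hx']

theorem adjoint_fourierOp_approx2Vec_iff {d : ℕ} {γ δ : ℝ} (hγ : 0 < γ) (hδ : 0 < δ)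
    (hγδ : γ * δ < 2) (j : Fin d) :
    ContinuousLinearMap.adjoint fourierOp (approx2Vec d γ δ j) =
      ∑ k, dftCoeff d j k • approx2Vec d γ δ k ↔ γ = δ := by
  refine ⟨fun h => ?_, fun h => by subst h; exact adjoint_fourierOp_approx2Vec hγ hδ j⟩
  have hc : ((√(alpha d * d) : ℝ) : ℂ) / ((√d : ℝ) : ℂ) ≠ 0 := by
    refine div_ne_zero (sqrt_alpha_mul_ne_zero j.pos) ?_
    have : (0 : ℝ) < d := by exact_mod_cast j.pos
    rw [Complex.ofReal_ne_zero]; positivity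
  have h1 := sum_dftCoeff_smul_approx2Vec_ae_eq hγ hδ j
  have h2 := sum_dftCoeff_smul_approx2Vec_ae_eq hδ hγ j
  rw [← adjoint_fourierOp_approx2Vec hγ hδ j, h] at h2
  have hy := summable_lattice (d := d) j.pos
  have hn := norm_dftPhase d j
  -- Both sides are continuous, so almost everywhere equality holds pointwise, as the translation
  -- argument requires.
  have h3 := (((continuous_combWave hγ hδ hn hy).const_mul _).ae_eq_iff_eq volume
    ((continuous_combWave hδ hγ hn hy).const_mul _)).1 (h1.symm.trans h2)
  refine eq_of_combWave_eq j hγ hδ hγδ (alpha_pos j.pos)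
    (funext fun x => mul_left_cancel₀ hc (congrFun h3 x)) ?_
  -- If the wave vanished identically, so would the image of the state under `F̂†`, contradicting
  -- injectivity.
  by_contra! h0
  have h4 : ContinuousLinearMap.adjoint fourierOp (approx2Vec d γ δ j) = 0 := by
    rw [h, Lp.eq_zero_iff_ae_eq_zero]
    filter_upwards [h1] with x hx
    rw [hx, h0, mul_zero, Pi.zero_apply]
  have h5 := fourierOp_adjoint_fourierOp (approx2Vec d γ δ j)
  rw [h4, map_zero] at h5
  exact approx2Vec_ne_zero hγ hδ j h5.symm

theorem adjoint_fourierOp_ket2_iff {d : ℕ} {γ δ : ℝ} (hγ : 0 < γ) (hδ : 0 < δ)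
    (hγδ : γ * δ < 2) (j : Fin d) :
    ContinuousLinearMap.adjoint fourierOp (ket2 d γ δ j) =
      ∑ k : Fin d, (dftCoeff d j k * ((√(N2 d γ δ k / N2 d γ δ j) : ℝ) : ℂ)) • ket2 d γ δ k ↔
      γ = δ := by
  rw [ket2, map_smul]
  exact (adjoint_fourierOp_normalized_iff (approx2Vec_ne_zero hγ hδ) j (approx2Vec_ne_zero hγ hδ j)).trans
    (adjoint_fourierOp_approx2Vec_iff hγ hδ hγδ j)

theorem N2_pos {d : ℕ} {γ δ : ℝ} (hγ : 0 < γ) (hδ : 0 < δ) (j : Fin d) : 0 < N2 d γ δ j :=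
  pow_pos (norm_pos_iff.2 (approx2Vec_ne_zero hγ hδ j)) 2

/-! ### Both widths negative -/

theorem errorWave_neg (γ δ : ℝ) : errorWave (-γ) (-δ) = errorWave γ δ := by
  ext r
  simp [errorWave]

open Classical in
theorem approx2Vec_neg (d : ℕ) (γ δ : ℝ) : approx2Vec d (-γ) (-δ) = approx2Vec d γ δ := by
  have h : IsApprox2Vec d (-γ) (-δ) = IsApprox2Vec d γ δ := by
    unfold IsApprox2Vec
    simp only [errorWave_neg]
  -- Choice depends only on the predicate, so equal predicates select the same vector without appeal
  -- to uniqueness.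
  have key : ∀ P Q : L2 → Prop, P = Q → (if h : ∃ f, P f then h.choose else 0) =
      if h : ∃ f, Q f then h.choose else 0 := by
    rintro P _ rfl
    rfl
  ext1 j
  exact key _ _ (congrFun h j)

theorem N2_neg (d : ℕ) (γ δ : ℝ) : N2 d (-γ) (-δ) = N2 d γ δ := by
  unfold N2
  rw [approx2Vec_neg]

theorem ket2_neg (d : ℕ) (γ δ : ℝ) : ket2 d (-γ) (-δ) = ket2 d γ δ := by
  unfold ket2
  rw [approx2Vec_neg, N2_neg]

end GKP

end

theorem corollary2 (d : ℕ) (hd : 0 < d) :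
    (∀ β : ℝ, 0 < β →
      (∀ j : Fin d, 0 < GKP.N3 d β j) ∧
      (∀ j : Fin d, ContinuousLinearMap.adjoint GKP.fourierOp (GKP.ket3 d β j) =
        ∑ k : Fin d, (GKP.dftCoeff d j k * ((√(GKP.N3 d β k / GKP.N3 d β j) : ℝ) : ℂ)) •
          GKP.ket3 d β k) ∧
      Submodule.map (GKP.fourierOp : GKP.L2 →ₗ[ℂ] GKP.L2) (GKP.codeSpace3 d β) =
        GKP.codeSpace3 d β) ∧
    (∀ γ δ : ℝ, 0 < γ * δ → γ * δ < 2 →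
      (∀ j : Fin d, 0 < GKP.N2 d γ δ j) ∧
      (∀ j : Fin d, ContinuousLinearMap.adjoint GKP.fourierOp (GKP.ket2 d γ δ j) =
          ∑ k : Fin d, (GKP.dftCoeff d j k * ((√(GKP.N2 d γ δ k / GKP.N2 d γ δ j) : ℝ) : ℂ)) •
            GKP.ket2 d γ δ k ↔ γ = δ)) := by
  refine ⟨fun β hβ => ⟨GKP.N3_pos hβ, GKP.adjoint_fourierOp_ket3 hβ,
    GKP.map_fourierOp_codeSpace3 hβ⟩, fun γ δ h0 h2 => ?_⟩
  rcases mul_pos_iff.1 h0 with ⟨hγ, hδ⟩ | ⟨hγ, hδ⟩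
  · exact ⟨GKP.N2_pos hγ hδ, GKP.adjoint_fourierOp_ket2_iff hγ hδ h2⟩
  -- `γδ > 0` also admits two negative widths; the states are unchanged under `(γ, δ) ↦ (-γ, -δ)`,
  -- and `-γ = -δ` is equivalent to `γ = δ`.
  · rw [← GKP.N2_neg, ← GKP.ket2_neg]
    refine ⟨GKP.N2_pos (neg_pos.2 hγ) (neg_pos.2 hδ), fun j => ?_⟩
    rw [GKP.adjoint_fourierOp_ket2_iff (neg_pos.2 hγ) (neg_pos.2 hδ) (by linarith) j, neg_inj]
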